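/- For $f\in\mathbb Z[x]$ write $f^0(x)=x$ and $f^{n}(x)=f(f^{n-1}(x))$ for $n\ge 1$. Say that a rational function $r\in\mathbb Q(x)$ has a specializable continued fraction if there are an integer $k\ge 0$ and polynomials $a_0,a_1,\dots,a_k\in\mathbb Z[x]$ (constants, including $0$, being allowed) such that $$r=[a_0,a_1,\dots,a_k]=a_0+\cfrac{1}{a_1+\cfrac{1}{a_2+\cdots+\cfrac{1}{a_k}}},$$ where no denominator in this expression vanishes. **Theorem.** Let $f(x)\in\mathbb Z[x]$ be a polynomial of degree greater than $1$. Then all of the partial sums $\sum_{n=0}^{N}\frac{1}{f^n(x)}$ ($N=0,1,2,\dots$) have specializable continued fractions if and only if $f(x)$ satisfies at least one of the following congruences in $\mathbb Z[x]$: 1. $f(x)\equiv 0 \pmod{x^2}$; 2. $f(x)\equiv -x \pmod{x^2}$; 3. $f(x)\equiv 1 \pmod{x^2(x-1)}$; 4. $f(x)\equiv -1 \pmod{x^2(x+1)}$; 5. $f(x)\equiv x^3-x^2-x+1 \pmod{x^2(x-1)^2}$; 6. $f(x)\equiv -x^3+2x^2-x+1 \pmod{x^2(x-1)^2}$; 7.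 $f(x)\equiv -x^3+3x^2-2x+1 \pmod{x^2(x-1)^2}$; 8. $f(x)\equiv x^3+x^2-x-1 \pmod{x^2(x+1)^2}$; 9. $f(x)\equiv -x^3-2x^2-x-1 \pmod{x^2(x+1)^2}$; 10. $f(x)\equiv -x^3-3x^2-2x-1 \pmod{x^2(x+1)^2}$; 11. $f(x)\equiv x^2-x+1 \pmod{x^2(x-1)^2}$; 12. $f(x)\equiv x^2-2x+1 \pmod{x^2(x-1)^2}$; 13. $f(x)\equiv -x^2-x-1 \pmod{x^2(x+1)^2}$; 14. $f(x)\equiv -x^2-2x-1 \pmod{x^2(x+1)^2}$. -/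

import Mathlib

open Polynomial

/-- `IsContFrac [a₀, a₁, …, aₙ] r` says that the finite continued fraction
`a₀ + 1/(a₁ + 1/(a₂ + ⋯ + 1/aₙ))` is well defined (no denominator that occurs in it vanishes)
and that its value is `r`. -/
inductive IsContFrac {K : Type*} [Field K] : List K → K → Prop
  | single (a : K) : IsContFrac [a] a
  | cons (a : K) (l : List K) (v : K) (h : IsContFrac l v) (hv : v ≠ 0) :
      IsContFrac (a :: l) (a + 1 / v)

/-- A polynomial with integer coefficients, seen in the field `ℚ(x)`. -/
noncomputable def intPolyToRatFunc (p : ℤ[X]) : RatFunc ℚ :=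
  algebraMap ℚ[X] (RatFunc ℚ) (p.map (Int.castRingHom ℚ))

/-- The rational function `r ∈ ℚ(x)` has a specializable continued fraction: it is the value of a
finite continued fraction all of whose partial quotients are polynomials with integer coefficients.
Constant partial quotients (also `0` and negative ones) are allowed. -/
def HasSpecializableContFrac (r : RatFunc ℚ) : Prop :=
  ∃ a : List ℤ[X], IsContFrac (a.map intPolyToRatFunc) r

/-- The `n`-th iterate of a polynomial: `f⁰(x) = x` and `fⁿ⁺¹(x) = f(fⁿ(x))`. -/
noncomputable def polyIterate (f : ℤ[X]) : ℕ → ℤ[X]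
  | 0 => X
  | n + 1 => f.comp (polyIterate f n)

/-- The partial sum `∑_{n=0}^{N} 1 / fⁿ(x)` in `ℚ(x)`. -/
noncomputable def iterSum (f : ℤ[X]) (N : ℕ) : RatFunc ℚ :=
  ∑ n ∈ Finset.range (N + 1), 1 / intPolyToRatFunc (polyIterate f n)

/-- Congruence in `ℤ[x]`: `f ≡ r (mod m)`. -/
def PolyCongr (f r m : ℤ[X]) : Prop := m ∣ f - r

/-! Since constant partial quotients are allowed, products of the matrices `!![a, 1; 1, 0]` include
all elementary matrices and diag(1, -1). A rational function thus has a specializable continued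
fraction exactly when it equals p/q for a first column (p, q), q ≠ 0, of such a product
(`IsElemPair`). Such a column generates the unit ideal, but over ℤ[x] the converse fails, and this
is the difficulty.

Necessity uses only N = 1, 2, 3 and two obstructions. First, p and q are coprime as ideals, so at a
zero of q the value of p is a unit (`IsSpecPair.eval_zero_eq`). Second, order ℤ[x] with x infinite:
this ring is discrete, so every continued fraction can be rewritten with all tails of absolute value
greater than 1, and hence lc(q) divides lc(p) when deg q < deg p (`IsSpecPair.leadingCoeff_dvd`).
The first obstruction gives f(0) ∈ {0, 1, -1} and settles f(0) = 0 (`necessity_zero`). For f(0) = 1,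
both together leave finitely many residues of f (`necessity_one`); f(0) = -1 is the mirror image
under f(x) ↦ -f(-x).

Sufficiency adds one term at a time by induction. The model is the folding lemma: p/q + 1/(tq²) is
elementary if p/q is (`IsElemPair.fold`). In general, adding 1/m to p/q needs only that m + vq be
elementary against q², where v is the inverse of p modulo q (`IsElemPair.add_frac`), and each
congruence controls that residue. When f is divisible by (x - 1)² and f(0) = 1, each iterate is a
multiple of the square of the one two steps before. The sums over even and odd indices then have
separate small denominators, and elementarity of the total is inherited from several earlier partial
sums (`IsElemPair.add_double`, `IsElemPair.add_single`). -/

/-! ### Products of the matrices `!![a, 1; 1, 0]` -/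

section ElemMonoid

variable {R : Type*} [CommRing R]

/-- The monoid generated by the matrices `!![a, 1; 1, 0]` of continued fractions. -/
def elemMonoid (R : Type*) [CommRing R] : Submonoid (Matrix (Fin 2) (Fin 2) R) :=
  Submonoid.closure (Set.range fun a : R => !![a, 1; 1, 0])

/-- `(p, q)` is the first column of a product of matrices `!![a, 1; 1, 0]`. -/
def IsElemPair (p q : R) : Prop := ∃ u v : R, !![p, u; q, v] ∈ elemMonoid R

theorem gen_mem_elemMonoid (a : R) : !![a, 1; 1, 0] ∈ elemMonoid R :=
  Submonoid.subset_closure ⟨a, rfl⟩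

theorem upper_mem_elemMonoid (a : R) : !![1, a; 0, 1] ∈ elemMonoid R := by
  have h := mul_mem (gen_mem_elemMonoid a) (gen_mem_elemMonoid (0 : R))
  simpa [Matrix.mul_fin_two] using h

theorem lower_mem_elemMonoid (a : R) : !![1, 0; a, 1] ∈ elemMonoid R := by
  have h := mul_mem (gen_mem_elemMonoid (0 : R)) (gen_mem_elemMonoid a)
  simpa [Matrix.mul_fin_two] using h

theorem diag_mem_elemMonoid : !![1, 0; 0, -1] ∈ elemMonoid R := by
  -- The first three factors multiply to the rotation `!![0, 1; -1, 0]`; the last one swaps its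
  -- columns.
  have h := mul_mem (mul_mem (mul_mem (upper_mem_elemMonoid (1 : R)) (lower_mem_elemMonoid (-1)))
    (upper_mem_elemMonoid 1)) (gen_mem_elemMonoid (0 : R))
  simpa [Matrix.mul_fin_two] using h

theorem transpose_mem_elemMonoid {M : Matrix (Fin 2) (Fin 2) R} (hM : M ∈ elemMonoid R) :
    M.transpose ∈ elemMonoid R := by
  induction hM using Submonoid.closure_induction with
  | mem M h =>
    obtain ⟨a, rfl⟩ := h
    convert gen_mem_elemMonoid a using 1
    ext i j; fin_cases i <;> fin_cases j <;> rfl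
  | one => simp
  | mul A B _ _ hA hB => rw [Matrix.transpose_mul]; exact mul_mem hB hA

theorem det_elemMonoid {M : Matrix (Fin 2) (Fin 2) R} (hM : M ∈ elemMonoid R) :
    M.det = 1 ∨ M.det = -1 := by
  induction hM using Submonoid.closure_induction with
  | mem M h => obtain ⟨a, rfl⟩ := h; right; simp [Matrix.det_fin_two]
  | one => simp
  | mul A B _ _ hA hB =>
    rw [Matrix.det_mul]
    rcases hA with h | h <;> rcases hB with h' | h' <;> simp [h, h']

namespace IsElemPair

-- A generator multiplied on the left undoes one step of the Euclidean algorithm.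
@[elab_as_elim]
theorem induct {C : R → R → Prop} (base : C 1 0) (step : ∀ a p q, C p q → C (a * p + q) p)
    {p q : R} (h : IsElemPair p q) : C p q := by
  obtain ⟨u, v, h⟩ := h
  have key : ∀ M ∈ elemMonoid R, C (M 0 0) (M 1 0) := by
    intro M hM
    induction hM using Submonoid.closure_induction_left with
    | one => simpa using base
    | mul_left A hA B hB ih =>
      obtain ⟨a, rfl⟩ := hA
      simpa [Matrix.mul_apply, Fin.sum_univ_two] using step a _ _ ih
  exact key _ h

theorem one_zero : IsElemPair (1 : R) 0 :=
  ⟨0, 1, by simpa [Matrix.one_fin_two] using one_mem (elemMonoid R)⟩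

theorem mul_mem {p u q v a b : R} (hM : !![p, u; q, v] ∈ elemMonoid R) (h : IsElemPair a b) :
    IsElemPair (p * a + u * b) (q * a + v * b) := by
  obtain ⟨c, d, h⟩ := h
  exact ⟨p * c + u * d, q * c + v * d, by
    simpa [Matrix.mul_fin_two] using Submonoid.mul_mem _ hM h⟩

theorem step {p q : R} (a : R) (h : IsElemPair p q) : IsElemPair (a * p + q) p := by
  simpa using mul_mem (gen_mem_elemMonoid a) h

theorem swap {p q : R} (h : IsElemPair p q) : IsElemPair q p := by
  simpa using step 0 h

theorem neg_right {p q : R} (h : IsElemPair p q) : IsElemPair p (-q) := by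
  simpa using mul_mem diag_mem_elemMonoid h

theorem neg_left {p q : R} (h : IsElemPair p q) : IsElemPair (-p) q :=
  h.swap.neg_right.swap

theorem neg_right_iff {p q : R} : IsElemPair p (-q) ↔ IsElemPair p q :=
  ⟨fun h => by simpa using h.neg_right, neg_right⟩

theorem add_mul_left {p q : R} (a : R) (h : IsElemPair p q) : IsElemPair (p + a * q) q := by
  simpa using mul_mem (upper_mem_elemMonoid a) h

theorem add_mul_right {p q : R} (a : R) (h : IsElemPair p q) : IsElemPair p (q + a * p) := by
  simpa [add_comm] using mul_mem (lower_mem_elemMonoid a) h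

/-- The first entry matters only modulo the second one. -/
theorem congr_left {p p' q : R} (h : IsElemPair p q) (hd : q ∣ p' - p) : IsElemPair p' q := by
  obtain ⟨w, hw⟩ := hd
  have := h.add_mul_left w
  rwa [show p + w * q = p' by linear_combination -hw] at this

theorem one_left (q : R) : IsElemPair 1 q := by
  simpa using one_zero.add_mul_right q

theorem one_right (p : R) : IsElemPair p 1 := by
  simpa using (one_zero.swap).add_mul_left p

theorem exists_det {p q : R} (h : IsElemPair p q) :
    ∃ u v : R, !![p, u; q, v] ∈ elemMonoid R ∧ p * v - u * q = 1 := by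
  obtain ⟨u, v, h⟩ := h
  rcases det_elemMonoid h with hd | hd <;> rw [Matrix.det_fin_two_of] at hd
  · exact ⟨u, v, h, hd⟩
  · refine ⟨-u, -v, ?_, by linear_combination -hd⟩
    simpa [Matrix.mul_fin_two] using Submonoid.mul_mem _ h diag_mem_elemMonoid

theorem isCoprime {p q : R} (h : IsElemPair p q) : IsCoprime p q := by
  obtain ⟨u, v, -, h⟩ := h.exists_det
  exact ⟨v, -u, by linear_combination h⟩

/-- Every completion of an elementary column to a matrix of determinant one is elementary. -/
theorem mem_of_det {p q u v : R} (h : IsElemPair p q) (hd : p * v - u * q = 1) :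
    !![p, u; q, v] ∈ elemMonoid R := by
  obtain ⟨u₀, v₀, hM, hd₀⟩ := h.exists_det
  -- Two completions of a column with determinant one differ by a unipotent right factor.
  have := Submonoid.mul_mem _ hM (upper_mem_elemMonoid (v₀ * u - u₀ * v))
  rw [Matrix.mul_fin_two] at this
  convert this using 1
  ext i j
  fin_cases i <;> fin_cases j <;> simp
  · linear_combination (-u) * hd₀ + u₀ * hd
  · linear_combination (-v) * hd₀ + v₀ * hd

theorem of_det_mul {p q u v a b : R} (h : IsElemPair p q) (hd : p * v - u * q = 1)
    (hab : IsElemPair a b) : IsElemPair (p * a + u * b) (q * a + v * b) :=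
  mul_mem (h.mem_of_det hd) hab

theorem inverse {p q u v : R} (h : IsElemPair p q) (hd : p * v - u * q = 1) :
    IsElemPair v q := by
  have hT : !![p, q; u, v] ∈ elemMonoid R := by
    convert transpose_mem_elemMonoid (h.mem_of_det hd) using 1
    ext i j; fin_cases i <;> fin_cases j <;> rfl
  have h2 : IsElemPair q v := by simpa using mul_mem hT one_zero.swap
  exact h2.swap

/-- The folding lemma. -/
theorem fold {p q : R} (h : IsElemPair p q) (t : R) :
    IsElemPair (1 + t * q * p) (t * q ^ 2) := by
  obtain ⟨u, v, -, hd⟩ := h.exists_det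
  -- Transposing makes (v, q) elementary; applying the original matrix to (v + tq, -q) gives (1 +
  -- tqp, tq²), because pv - uq = 1.
  have h1 : IsElemPair (v + t * q) (-q) := by
    have := ((h.inverse hd).add_mul_left t).neg_right
    exact this
  have := h.of_det_mul hd h1
  convert this using 1
  · linear_combination -hd
  · ring

/-- The folding lemma, for the inverse residue. -/
theorem fold_inverse {p q u v : R} (h : IsElemPair p q) (hd : p * v - u * q = 1) (t : R) :
    IsElemPair (1 + t * q * v) (t * q ^ 2) :=
  (h.inverse hd).fold t

/-- Adding a fraction `n / m` to the value of an elementary pair. -/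
theorem add_frac {p q u v n m : R} (h : IsElemPair p q) (hd : p * v - u * q = 1)
    (h1 : IsElemPair (m + v * n * q) (n * q ^ 2)) : IsElemPair (p * m + n * q) (q * m) := by
  have := h.of_det_mul hd h1.neg_right
  convert this using 1
  · linear_combination -n * q * hd
  · ring

end IsElemPair

end ElemMonoid

/-! ### Specializable continued fractions and elementary pairs -/

theorem intPolyToRatFunc_injective : Function.Injective intPolyToRatFunc :=
  (RatFunc.algebraMap_injective ℚ).comp
    (Polynomial.map_injective _ (RingHom.injective_int (Int.castRingHom ℚ)))

/-- `intPolyToRatFunc` as a ring homomorphism. -/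
noncomputable def intPolyHom : ℤ[X] →+* RatFunc ℚ :=
  (algebraMap ℚ[X] (RatFunc ℚ)).comp (Polynomial.mapRingHom (Int.castRingHom ℚ))

theorem intPolyHom_apply (p : ℤ[X]) : intPolyHom p = intPolyToRatFunc p := rfl

theorem intPolyHom_injective : Function.Injective intPolyHom := intPolyToRatFunc_injective

theorem intPolyHom_ne_zero {p : ℤ[X]} (hp : p ≠ 0) : intPolyHom p ≠ 0 :=
  (map_ne_zero_iff _ intPolyHom_injective).mpr hp

theorem IsElemPair.hasSpecializableContFrac {p q : ℤ[X]} (h : IsElemPair p q) (hq : q ≠ 0) :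
    HasSpecializableContFrac (intPolyHom p / intPolyHom q) := by
  refine h.induct (C := fun p q => q ≠ 0 →
    HasSpecializableContFrac (intPolyHom p / intPolyHom q)) (fun h => absurd rfl h) ?_ hq
  intro a p q ih hp
  have hp' := intPolyHom_ne_zero hp
  by_cases hq : q = 0
  · refine ⟨[a], ?_⟩
    rw [hq, add_zero, map_mul, mul_div_assoc, div_self hp', mul_one]
    exact IsContFrac.single _
  · obtain ⟨l, hl⟩ := ih hq
    have hq' := intPolyHom_ne_zero hq
    refine ⟨a :: l, ?_⟩
    have := IsContFrac.cons (intPolyHom a) _ _ hl (div_ne_zero hp' hq')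
    rw [one_div_div] at this
    convert this using 1
    · rfl
    · rw [map_add, map_mul]
      field_simp

theorem HasSpecializableContFrac.exists_isElemPair {r : RatFunc ℚ}
    (h : HasSpecializableContFrac r) :
    ∃ p q : ℤ[X], IsElemPair p q ∧ q ≠ 0 ∧ r = intPolyHom p / intPolyHom q := by
  obtain ⟨l, hl⟩ := h
  induction l generalizing r with
  | nil => cases hl
  | cons a l ih =>
    rw [List.map_cons] at hl
    generalize hm : l.map intPolyToRatFunc = m at hl
    cases hl with
    | single => exact ⟨a, 1, .one_right a, one_ne_zero, by rw [map_one, div_one]; rfl⟩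
    | cons _ _ v hv hv0 =>
      subst hm
      obtain ⟨p, q, hpq, hq, rfl⟩ := ih hv
      have hp : p ≠ 0 := by rintro rfl; simp at hv0
      refine ⟨a * p + q, p, hpq.step a, hp, ?_⟩
      have := intPolyHom_ne_zero hp
      rw [one_div_div, map_add, map_mul, ← intPolyHom_apply]
      field_simp

/-- The fraction `p / q` equals the quotient of an elementary pair. -/
def IsSpecPair {R : Type*} [CommRing R] (p q : R) : Prop :=
  ∃ h P Q : R, IsElemPair P Q ∧ p = h * P ∧ q = h * Q

namespace IsSpecPair

section

variable {R : Type*} [CommRing R] {p q : R}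

theorem mul_left {p u q v a b : R} (hM : !![p, u; q, v] ∈ elemMonoid R) (h : IsSpecPair a b) :
    IsSpecPair (p * a + u * b) (q * a + v * b) := by
  obtain ⟨w, P, Q, h, rfl, rfl⟩ := h
  exact ⟨w, _, _, h.mul_mem hM, by ring, by ring⟩

theorem swap (h : IsSpecPair p q) : IsSpecPair q p := by
  simpa using h.mul_left (gen_mem_elemMonoid 0)

theorem congr_left {p' : R} (h : IsSpecPair p q) (hd : q ∣ p' - p) : IsSpecPair p' q := by
  obtain ⟨w, hw⟩ := hd
  have := h.mul_left (upper_mem_elemMonoid w)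
  convert this using 1
  · linear_combination hw
  · ring

theorem congr_right {q' : R} (h : IsSpecPair p q) (hd : p ∣ q' - q) : IsSpecPair p q' :=
  (h.swap.congr_left hd).swap

theorem neg_right (h : IsSpecPair p q) : IsSpecPair p (-q) := by
  simpa using h.mul_left diag_mem_elemMonoid

theorem neg_left (h : IsSpecPair p q) : IsSpecPair (-p) q := h.swap.neg_right.swap

theorem mul_inv {p u q v a b : R} (hE : IsElemPair p q) (hd : p * v - u * q = 1)
    (h : IsSpecPair a b) : IsSpecPair (v * a - u * b) (p * b - q * a) := by
  have h1 : !![v, -u; -q, p] ∈ elemMonoid R :=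
    (hE.inverse hd).neg_right.mem_of_det (by linear_combination hd)
  have := h.mul_left h1
  convert this using 1 <;> ring

/-- Bezout coefficients of the elementary pair (P, Q) express the common factor k through wp and wq,
so w divides k. -/
theorem cancel [IsDomain R] {w : R} (hw : w ≠ 0) (h : IsSpecPair (w * p) (w * q)) :
    IsSpecPair p q := by
  obtain ⟨k, P, Q, hE, h1, h2⟩ := h
  obtain ⟨u, v, huv⟩ := hE.isCoprime
  have hk : k = w * (u * p + v * q) := by linear_combination u * (-h1) - v * h2 - k * huv
  refine ⟨u * p + v * q, P, Q, hE, mul_left_cancel₀ hw ?_, mul_left_cancel₀ hw ?_⟩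
  · rw [h1, hk]; ring
  · rw [h2, hk]; ring

theorem map {S : Type*} [CommRing S] (φ : R →+* S) (h : IsSpecPair p q) :
    IsSpecPair (φ p) (φ q) := by
  obtain ⟨k, P, Q, hE, rfl, rfl⟩ := h
  refine ⟨φ k, φ P, φ Q, ?_, map_mul _ _ _, map_mul _ _ _⟩
  refine hE.induct (C := fun P Q => IsElemPair (φ P) (φ Q)) (by simpa using .one_zero) ?_
  intro a p q h
  simpa using h.step (φ a)

/-- A nonunit common factor would contain a prime dividing both entries, so the factor is a unit and
the Bezout relation of the elementary pair carries over. -/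
theorem isCoprime [IsDomain R] [WfDvdMonoid R] [DecompositionMonoid R] (h : IsSpecPair p q)
    (h0 : p ≠ 0 ∨ q ≠ 0)
    (hpq : ∀ π : R, Prime π → π ∣ p → π ∣ q → False) : IsCoprime p q := by
  obtain ⟨k, P, Q, hE, rfl, rfl⟩ := h
  have hk0 : k ≠ 0 := by rintro rfl; simp at h0
  have hk : IsUnit k := by
    by_contra hk
    obtain ⟨π, hπ, hd⟩ := WfDvdMonoid.exists_irreducible_factor hk hk0
    exact hpq π hπ.prime (hd.mul_right _) (hd.mul_right _)
  exact (isCoprime_mul_unit_left hk P Q).mpr hE.isCoprime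

end

theorem of_hasSpecializableContFrac {p q : ℤ[X]} (hq : q ≠ 0)
    (h : HasSpecializableContFrac (intPolyHom p / intPolyHom q)) : IsSpecPair p q := by
  obtain ⟨P, Q, hE, hQ, h⟩ := h.exists_isElemPair
  have h1 := intPolyHom_ne_zero hq
  have h2 := intPolyHom_ne_zero hQ
  rw [div_eq_div_iff h1 h2, ← map_mul, ← map_mul] at h
  have h3 : p * Q = P * q := intPolyHom_injective h
  obtain ⟨u, v, huv⟩ := hE.isCoprime
  refine ⟨u * p + v * q, P, Q, hE, ?_, ?_⟩
  · linear_combination -p * huv + v * h3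
  · linear_combination -q * huv - u * h3

end IsSpecPair

/-! ### Leading coefficients of elementary pairs -/

section NearestQuotient

variable {K : Type*} [Field K] [LinearOrder K]

/-- Values of continued fractions over a subring `D` all of whose tails have absolute value
greater than one. -/
inductive NearFrac (D : Subring K) : K → Prop
  | base (a : K) (ha : a ∈ D) : NearFrac D a
  | step (a v : K) (ha : a ∈ D) (h : NearFrac D v) (hv : 1 < |v|) : NearFrac D (a + v⁻¹)

namespace NearFrac

variable {D : Subring K}

theorem add_mem {r a : K} (h : NearFrac D r) (ha : a ∈ D) : NearFrac D (r + a) := by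
  cases h with
  | base b hb => exact .base _ (D.add_mem hb ha)
  | step b v hb h hv =>
    rw [add_right_comm]
    exact .step _ _ (D.add_mem hb ha) h hv

theorem neg {r : K} (h : NearFrac D r) : NearFrac D (-r) := by
  induction h with
  | base a ha => exact .base _ (D.neg_mem ha)
  | step a v ha h hv ih =>
    rw [neg_add, ← inv_neg]
    exact .step _ _ (D.neg_mem ha) ih (by rwa [abs_neg])

theorem inv_of_one_lt {r : K} (h : NearFrac D r) (hr : 1 < |r|) : NearFrac D r⁻¹ := by
  simpa using NearFrac.step 0 r D.zero_mem h hr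

variable [IsStrictOrderedRing K]

/-- The discreteness of `D` makes these values stable under inversion. -/
theorem inv (hD : ∀ a ∈ D, a ≠ 0 → 1 ≤ |a|) {r : K} (h : NearFrac D r) : NearFrac D r⁻¹ := by
  -- The shift by b is built in because the case |c + 1/v| < 1 needs the induction hypothesis at v -
  -- 1 or v + 1.
  suffices H : ∀ b ∈ D, NearFrac D (r + b)⁻¹ by simpa using H 0 D.zero_mem
  induction h with
  | base a ha =>
    intro b hb
    have hab := D.add_mem ha hb
    rcases lt_trichotomy |a + b| 1 with h | h | h
    · have : a + b = 0 := by
        by_contra h0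
        exact absurd (hD _ hab h0) (not_le.mpr h)
      rw [this, inv_zero]
      exact .base _ D.zero_mem
    · rcases eq_or_eq_neg_of_abs_eq h with h | h <;> rw [h]
      · simpa using NearFrac.base 1 D.one_mem
      · simpa [inv_neg] using NearFrac.base (-1) (D.neg_mem D.one_mem)
    · exact (NearFrac.base _ hab).inv_of_one_lt h
  | step a v ha h hv ih =>
    intro b hb
    rw [add_right_comm]
    obtain ⟨c, hc⟩ : ∃ c, c = a + b := ⟨_, rfl⟩
    have hcD : c ∈ D := hc ▸ D.add_mem ha hb
    rw [← hc]
    have hr : NearFrac D (c + v⁻¹) := .step _ _ hcD h hv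
    rcases lt_trichotomy |c + v⁻¹| 1 with h1 | h1 | h1
    · have hv0 : v ≠ 0 := by rintro rfl; simp at hv; linarith
      have hvi : |v⁻¹| < 1 := by rw [abs_inv]; exact inv_lt_one_of_one_lt₀ hv
      rw [abs_lt] at hvi h1
      by_cases hc0 : c = 0
      · simpa [hc0] using h
      · rcases lt_or_gt_of_ne hc0 with hneg | hpos
        · have hc1 : c = -1 := by
            by_contra hne
            have h2 := hD c hcD hc0
            rw [abs_of_neg hneg] at h2
            have h3 := hD (c + 1) (D.add_mem hcD D.one_mem) (fun h => hne (by linarith))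
            rw [abs_of_nonpos (by linarith)] at h3
            linarith
          subst hc1
          have hvpos : 0 < v := inv_pos.mp (by linarith)
          rw [abs_of_pos hvpos] at hv
          -- Here 1/(-1 + 1/v) = -1 - 1/(v - 1); the case c = 1 below uses 1/(1 + 1/v) = 1 - 1/(v +
          -- 1).
          have h4 := (ih (-1) hcD).neg.add_mem hcD
          convert h4 using 1
          have : v + -1 ≠ 0 := by intro h; linarith
          have h5 : -1 + v⁻¹ ≠ 0 := by
            rw [← one_div]; intro h; field_simp at h; exact this (by linarith)
          field_simp
          have : -v + 1 ≠ 0 := by intro h; linarith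
          field_simp
          ring
        · have hc1 : c = 1 := by
            by_contra hne
            have h2 := hD c hcD hc0
            rw [abs_of_pos hpos] at h2
            have h3 := hD (c - 1) (D.sub_mem hcD D.one_mem) (fun h => hne (by linarith))
            rw [abs_of_nonneg (by linarith)] at h3
            linarith
          subst hc1
          have hvneg : v < 0 := inv_lt_zero.mp (by linarith)
          rw [abs_of_neg hvneg] at hv
          have h4 := (ih 1 hcD).neg.add_mem hcD
          convert h4 using 1
          have : v + 1 ≠ 0 := by intro h; linarith
          have h5 : 1 + v⁻¹ ≠ 0 := by
            rw [← one_div]; intro h; field_simp at h; exact this (by simpa using h)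
          field_simp
          ring
    · rcases eq_or_eq_neg_of_abs_eq h1 with h | h <;> rw [h]
      · simpa using NearFrac.base 1 D.one_mem
      · simpa [inv_neg] using NearFrac.base (-1) (D.neg_mem D.one_mem)
    · exact hr.inv_of_one_lt h1

theorem exists_abs_sub_lt {r : K} (h : NearFrac D r) : ∃ a ∈ D, |r - a| < 1 := by
  cases h with
  | base => exact ⟨r, by assumption, by simp⟩
  | step a v ha h hv =>
    refine ⟨a, ha, ?_⟩
    rw [add_sub_cancel_left, abs_inv]
    exact inv_lt_one_of_one_lt₀ hv

end NearFrac

end NearestQuotient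

/-- The germ at infinity of an integer polynomial, as a hyperreal number. -/
noncomputable def evalOmega : ℤ[X] →+* Hyperreal :=
  (Filter.Germ.coeRingHom (Filter.hyperfilter ℕ : Filter ℕ)).comp
    (RingHom.pi fun n : ℕ => Polynomial.eval₂RingHom (Int.castRingHom ℝ) (n : ℝ))

theorem evalOmega_apply (p : ℤ[X]) :
    evalOmega p = Hyperreal.ofSeq fun n => (p.map (Int.castRingHom ℝ)).eval (n : ℝ) := by
  simp only [Polynomial.eval_map]
  rfl

theorem abs_evalOmega (p : ℤ[X]) :
    |evalOmega p| = Hyperreal.ofSeq fun n => |(p.map (Int.castRingHom ℝ)).eval (n : ℝ)| := by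
  rw [evalOmega_apply]
  exact Filter.Germ.abs_def _

theorem abs_evalOmega_lt {p q : ℤ[X]} (h : p.degree < q.degree) :
    |evalOmega p| < |evalOmega q| := by
  rw [abs_evalOmega, abs_evalOmega, Hyperreal.ofSeq_lt_ofSeq]
  refine Filter.Eventually.filter_mono Nat.hyperfilter_le_atTop ?_
  have hinj : Function.Injective (Int.castRingHom ℝ) := RingHom.injective_int _
  have hq : q.map (Int.castRingHom ℝ) ≠ 0 := by
    rw [Ne, Polynomial.map_eq_zero_iff hinj]
    rintro rfl
    simp at h
  have h1 := Polynomial.div_tendsto_atTop_zero_of_degree_lt (p.map (Int.castRingHom ℝ))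
    (q.map (Int.castRingHom ℝ))
    (by rwa [Polynomial.degree_map_eq_of_injective hinj,
      Polynomial.degree_map_eq_of_injective hinj])
  have h2 := (h1.comp tendsto_natCast_atTop_atTop).eventually (Metric.ball_mem_nhds 0 one_pos)
  have h3 := tendsto_natCast_atTop_atTop.eventually
    (Polynomial.eventually_atTop_not_isRoot (q.map (Int.castRingHom ℝ)) hq)
  filter_upwards [h2, h3] with n hn hn'
  simp only [Function.comp, dist_zero_right, Real.norm_eq_abs, abs_div] at hn
  exact (div_lt_one (abs_pos.mpr hn')).mp hn

theorem one_le_abs_evalOmega {p : ℤ[X]} (hp : p ≠ 0) : 1 ≤ |evalOmega p| := by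
  rcases lt_or_ge (0 : WithBot ℕ) p.degree with h | h
  · have := abs_evalOmega_lt (p := 1) (q := p) (by rwa [Polynomial.degree_one])
    rw [map_one, abs_one] at this
    exact this.le
  · rw [Polynomial.eq_C_of_degree_le_zero h] at hp ⊢
    have hc : p.coeff 0 ≠ 0 := by simpa using hp
    rw [eq_intCast C, map_intCast, ← Int.cast_abs]
    exact_mod_cast Int.one_le_abs hc

/-- Nonzero integer polynomials have absolute value at least 1 at infinity, so every inversion in
the continued fraction can be renormalized. -/
theorem IsElemPair.nearFrac {p q : ℤ[X]} (h : IsElemPair p q) :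
    NearFrac evalOmega.range (evalOmega p / evalOmega q) := by
  have hD : ∀ a ∈ evalOmega.range, a ≠ 0 → 1 ≤ |a| := by
    rintro _ ⟨p, rfl⟩ h
    exact one_le_abs_evalOmega (by rintro rfl; simp at h)
  refine h.induct (C := fun p q => NearFrac evalOmega.range (evalOmega p / evalOmega q))
    (by simpa using NearFrac.base 0 (zero_mem _)) ?_
  intro a p q ih
  by_cases hp : evalOmega p = 0
  · simpa [hp] using NearFrac.base 0 (zero_mem evalOmega.range)
  · have := (ih.inv hD).add_mem ⟨a, rfl⟩
    convert this using 1
    rw [map_add, map_mul]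
    field_simp
    ring

/-- The division step that every fraction with an elementary continued fraction admits. -/
theorem IsSpecPair.leadingCoeff_dvd {p q : ℤ[X]} (h : IsSpecPair p q) (hq : q ≠ 0)
    (hd : q.degree < p.degree) : q.leadingCoeff ∣ p.leadingCoeff := by
  obtain ⟨w, P, Q, hE, rfl, rfl⟩ := h
  -- Some polynomial a satisfies |P/Q - a| < 1, so deg(P - Qa) ≤ deg Q < deg P and P has the leading
  -- coefficient of Qa.
  obtain ⟨_, ⟨a, rfl⟩, ha⟩ := hE.nearFrac.exists_abs_sub_lt
  have hw : w ≠ 0 := left_ne_zero_of_mul hq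
  have hQ : Q ≠ 0 := right_ne_zero_of_mul hq
  have hQ' : 0 < |evalOmega Q| := lt_of_lt_of_le one_pos (one_le_abs_evalOmega hQ)
  have h1 : |evalOmega (P - Q * a)| < |evalOmega Q| := by
    have : evalOmega (P - Q * a) = (evalOmega P / evalOmega Q - evalOmega a) * evalOmega Q := by
      have := abs_pos.mp hQ'
      rw [map_sub, map_mul]
      field_simp
    rw [this, abs_mul]
    exact (mul_lt_iff_lt_one_left hQ').mpr ha
  have h2 : (P - Q * a).degree ≤ Q.degree := by
    by_contra hlt
    exact absurd (abs_evalOmega_lt (not_le.mp hlt)) (not_lt.mpr h1.le)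
  rw [degree_mul, degree_mul] at hd
  have h3 : Q.degree < P.degree := by
    by_contra hlt
    exact absurd hd (not_lt.mpr (add_le_add_right (not_lt.mp hlt) _))
  have h4 := leadingCoeff_sub_of_degree_lt (h2.trans_lt h3)
  rw [sub_sub_cancel, leadingCoeff_mul] at h4
  rw [leadingCoeff_mul, leadingCoeff_mul, ← h4]
  exact mul_dvd_mul_left _ (dvd_mul_right _ _)

/-! ### Necessity -/

/-- `p` has degree `n` and leading coefficient `a`. -/
def HasLead (p : ℤ[X]) (n : ℕ) (a : ℤ) : Prop := a ≠ 0 ∧ p.coeff n = a ∧ p.natDegree ≤ n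

namespace HasLead

variable {p q : ℤ[X]} {n m : ℕ} {a b : ℤ}

theorem natDegree_eq (h : HasLead p n a) : p.natDegree = n :=
  le_antisymm h.2.2 (le_natDegree_of_ne_zero (h.2.1 ▸ h.1))

theorem ne_zero (h : HasLead p n a) : p ≠ 0 := by
  rintro rfl
  exact h.1 (by simpa using h.2.1.symm)

theorem leadingCoeff_eq (h : HasLead p n a) : p.leadingCoeff = a := by
  rw [leadingCoeff, h.natDegree_eq, h.2.1]

theorem of_ne_zero (h : p ≠ 0) : HasLead p p.natDegree p.leadingCoeff :=
  ⟨leadingCoeff_ne_zero.mpr h, rfl, le_rfl⟩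

theorem mul (h : HasLead p n a) (h' : HasLead q m b) : HasLead (p * q) (n + m) (a * b) :=
  ⟨mul_ne_zero h.1 h'.1, by rw [coeff_mul_add_eq_of_natDegree_le h.2.2 h'.2.2, h.2.1, h'.2.1],
    natDegree_mul_le_of_le h.2.2 h'.2.2⟩

theorem add_lower (h : HasLead p n a) (hq : q.natDegree < n) : HasLead (p + q) n a :=
  ⟨h.1, by rw [coeff_add, h.2.1, coeff_eq_zero_of_natDegree_lt hq, add_zero],
    natDegree_add_le_of_degree_le h.2.2 hq.le⟩

theorem linear (ha : a ≠ 0) (b : ℤ) : HasLead (C a * X + C b) 1 a :=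
  ⟨ha, by rw [coeff_add, coeff_C_mul, coeff_X_one, coeff_C_of_ne_zero one_ne_zero, mul_one, add_zero],
    by compute_degree⟩

theorem const (ha : a ≠ 0) : HasLead (C a) 0 a := ⟨ha, by simp, by simp⟩

theorem X_one : HasLead X 1 1 := ⟨one_ne_zero, by simp, by simp⟩

theorem neg (h : HasLead p n a) : HasLead (-p) n (-a) :=
  ⟨neg_ne_zero.mpr h.1, by rw [coeff_neg, h.2.1], by rw [natDegree_neg]; exact h.2.2⟩

end HasLead

theorem IsSpecPair.lead_dvd {p q : ℤ[X]} {n m : ℕ} {a b : ℤ} (h : IsSpecPair p q)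
    (hp : HasLead p n a) (hq : HasLead q m b) (hmn : m < n) : b ∣ a := by
  rw [← hp.leadingCoeff_eq, ← hq.leadingCoeff_eq]
  refine h.leadingCoeff_dvd hq.ne_zero ?_
  rw [degree_eq_natDegree hq.ne_zero, degree_eq_natDegree hp.ne_zero, hp.natDegree_eq,
    hq.natDegree_eq]
  exact_mod_cast hmn

theorem Int.eq_of_mul_dvd_self {w l : ℤ} (hl : l ≠ 0) (h : w * l ∣ l) : w = 1 ∨ w = -1 := by
  obtain ⟨k, hk⟩ := h
  have : w * k = 1 := mul_left_cancel₀ hl (by linear_combination -hk)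
  exact Int.isUnit_iff.mp (IsUnit.of_mul_eq_one _ this)

theorem IsSpecPair.isElemPair {p q u v : ℤ[X]} (h : IsSpecPair p q) (hd : p * v - u * q = 1) :
    IsElemPair p q := by
  obtain ⟨k, P, Q, hE, rfl, rfl⟩ := h
  have hk : IsUnit k := IsUnit.of_mul_eq_one (P * v - u * Q) (by linear_combination hd)
  obtain ⟨r, hr, rfl⟩ := Polynomial.isUnit_iff.mp hk
  rcases Int.isUnit_iff.mp hr with rfl | rfl
  · simpa using hE
  · simpa using hE.neg_left.neg_right

theorem eval_zero_of_prime_dvd {π q : ℤ[X]} (hπ : Prime π) (hX : π ∣ X) (hq : π ∣ q) :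
    q.eval 0 = 0 := by
  have : Associated π X := hπ.associated_of_dvd prime_X hX
  have := this.symm.dvd.trans hq
  rw [X_dvd_iff, coeff_zero_eq_eval_zero] at this
  exact this

/-- Evaluating a Bezout relation at 0 makes p(0) a unit of ℤ. The prime x needs no check, as p(0) ≠
0. -/
theorem IsSpecPair.eval_zero_eq {p q : ℤ[X]} (h : IsSpecPair p q) (hp : p.eval 0 ≠ 0)
    (hq : q.eval 0 = 0)
    (hpq : ∀ π : ℤ[X], Prime π → ¬ π ∣ X → π ∣ p → π ∣ q → False) :
    p.eval 0 = 1 ∨ p.eval 0 = -1 := by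
  have h1 : IsCoprime p q := by
    refine h.isCoprime (Or.inl ?_) fun π hπ h1 h2 => ?_
    · rintro rfl; simp at hp
    · exact hpq π hπ (fun hX => hp (eval_zero_of_prime_dvd hπ hX h1)) h1 h2
  obtain ⟨u, v, huv⟩ := h1
  have := congrArg (eval 0) huv
  simp only [eval_add, eval_mul, hq, eval_one, mul_zero, add_zero] at this
  exact Int.isUnit_iff.mp (IsUnit.of_mul_eq_one (u.eval 0) (by linear_combination this))

/-! ### The case f(0) = 0 -/

section ZeroFixed

variable {f g : ℤ[X]}

/-- After cancelling x, the sum with N = 1 has numerator 1 + g, which leaves only g(0) = -2 to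
exclude. For that value the reduced numerator with N = 2 takes the value 3 at 0, which is not a
unit. -/
theorem necessity_zero (hf : f = X * g)
    (h1 : IsSpecPair (X + f) (X * f))
    (h2 : IsSpecPair ((X + f) * f.comp f + X * f) (X * f * f.comp f)) (hg : g ≠ 0) :
    g.eval 0 = 0 ∨ g.eval 0 = -1 := by
  by_contra! hne
  obtain ⟨hne0, hne1⟩ := hne
  have hX : (X : ℤ[X]) ≠ 0 := X_ne_zero
  have hgf : f.comp f = f * g.comp f := by
    simpa using congrArg (fun p => p.comp f) hf
  have hg0 : f ∣ g.comp f - C (g.eval 0) := by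
    have : X ∣ g - C (g.eval 0) := by
      rw [X_dvd_iff]; simp [coeff_zero_eq_eval_zero]
    obtain ⟨w, hw⟩ := this
    refine ⟨w.comp f, ?_⟩
    have := congrArg (fun p => comp p f) hw
    simpa using this
  have hf0 : f.eval 0 = 0 := by rw [hf]; simp
  have e1 : g.eval 0 = -2 := by
    have h3 : IsSpecPair (1 + g) (X * g) := by
      refine IsSpecPair.cancel hX ?_
      convert h1 using 1 <;> rw [hf] <;> ring
    have := h3.eval_zero_eq (by simp; omega) (by simp) fun π hπ hπX h1 h2 => by
      rcases hπ.dvd_or_dvd h2 with h | h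
      · exact hπX h
      · exact hπ.not_dvd_one ((dvd_add_left h).mp h1)
    simp at this
    omega
  set γ := g.comp f with hγ
  have hγ0 : γ.eval 0 = -2 := by rw [hγ, eval_comp, hf0, e1]
  have h3 : IsSpecPair (g * γ + γ + 1) (X * g * γ) := by
    have hf' : f ≠ 0 := by rw [hf]; exact mul_ne_zero hX hg
    refine IsSpecPair.cancel (mul_ne_zero hX hf') ?_
    convert h2 using 1 <;> rw [hgf, hf] <;> ring
  have := h3.eval_zero_eq (by simp [hγ0, e1]) (by simp) fun π hπ hπX h1 h2 => by
    rcases hπ.dvd_or_dvd h2 with h | h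
    · rcases hπ.dvd_or_dvd h with h | h
      · exact hπX h
      · have h4 : π ∣ γ - C (-2) := by
          rw [← e1]; exact (h.trans (by rw [hf]; exact dvd_mul_left _ _)).trans hg0
        obtain ⟨a, ha⟩ := h1
        obtain ⟨b, hb⟩ := h
        obtain ⟨c, hc⟩ := h4
        refine hπ.not_dvd_one ⟨-a + b * γ + c, ?_⟩
        simp only [map_neg, map_ofNat] at hc
        linear_combination -ha + γ * hb + hc
    · refine hπ.not_dvd_one ((dvd_add_right ?_).mp h1)
      rw [← add_one_mul]; exact h.mul_left _
  simp [hγ0, e1] at this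

end ZeroFixed

/-! ### The case f(0) = 1 -/

section ZeroToOne

variable {f : ℤ[X]}

/-- Division reduces the sum with N = 1 to ((c + 1)x + 1, x²), so c + 1 must divide 1 unless it is
zero. -/
theorem linear_coeff_of_isSpecPair {g : ℤ[X]} {c : ℤ} (hf : f = 1 + C c * X + X ^ 2 * g)
    (h1 : IsSpecPair (X + f) (X * f)) : c = 0 ∨ c = -1 ∨ c = -2 := by
  by_cases hc : c + 1 = 0
  · omega
  · have h2 : IsSpecPair (X + f) (X ^ 2) := by
      have := (h1.congr_right (q' := - X ^ 2) ⟨-X, by ring⟩).neg_right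
      simpa using this
    have h3 : IsSpecPair (C (c + 1) * X + C 1) (X ^ 2) :=
      h2.congr_left ⟨-g, by rw [hf]; simp only [map_add, map_one]; ring⟩
    have h4 : HasLead (X ^ 2 : ℤ[X]) 2 1 := by
      rw [sq]; simpa using HasLead.X_one.mul HasLead.X_one
    have := h3.swap.lead_dvd h4 (.linear hc 1) (by norm_num)
    rcases Int.isUnit_iff.mp (isUnit_of_dvd_one this) with h | h <;> omega

variable {κ : ℤ[X]} {c A G : ℤ}

/-- Undoing the matrix of the sum with N = 1 leaves a small column; reduction modulo x²f² then keeps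
only the Taylor data c, A, G. -/
theorem isSpecPair_two (hf : f = 1 + C c * X + X ^ 2 * (C A + C G * (X - 1) + (X - 1) ^ 2 * κ))
    (h1 : IsSpecPair (X + f) (X * f))
    (h2 : IsSpecPair ((X + f) * f.comp f + X * f) (X * f * f.comp f)) :
    IsSpecPair (1 + C (c + 1) * f + (C (G * c + 1 + c) * X + C (A - 1)) * f ^ 2)
      (X ^ 2 * f ^ 2) := by
  obtain ⟨g, hg⟩ : ∃ g, g = C A + C G * (X - 1) + (X - 1) ^ 2 * κ := ⟨_, rfl⟩
  have hY : f.comp f = 1 + C c * f + f ^ 2 * (C A + C G * (f - 1) + (f - 1) ^ 2 * κ.comp f) := by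
    simpa using congrArg (fun p => p.comp f) hf
  rw [← hg] at hf
  have hd : (X + f) * (-C c - X * g + (1 + C c) * f)
      - (-g + (1 + C c) * (1 + C c + X * g)) * (X * f) = 1 := by
    rw [hf]; ring
  have h3 := IsSpecPair.mul_inv (h1.isElemPair hd) hd h2
  have h4 : IsSpecPair (f.comp f + (-C c - X * g + (1 + C c) * f) * (X * f)) (X ^ 2 * f ^ 2) := by
    convert h3.neg_right using 1
    · linear_combination (-f.comp f) * hd
    · ring
  refine h4.congr_left ⟨-(C G * g + (C c + X * g) ^ 2 * κ.comp f), ?_⟩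
  have hk : f - 1 = X * (C c + X * g) := by rw [hf]; ring
  have e1 : f ^ 2 * (f - 1) ^ 2 * κ.comp f = f ^ 2 * (X * (C c + X * g)) ^ 2 * κ.comp f := by
    rw [hk]
  have e2 : C G * f ^ 2 * (f - 1) = C G * f ^ 2 * (X * (C c + X * g)) := by rw [hk]
  simp only [map_add, map_sub, map_mul, map_one]
  rw [hY]
  linear_combination (-1 : ℤ[X]) * e1 - e2 - f * hk

/-- One division bounds w₁. If w₁ = ±1, a second one bounds w₀, since x² - (w₁x - w₀)(w₁x + w₀) =
w₀². -/
theorem bounds_of_isSpecPair {b w₀ w₁ : ℤ} (hf : 1 < f.natDegree)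
    (h : IsSpecPair (1 + C b * f + (C w₁ * X + C w₀) * f ^ 2) (X ^ 2 * f ^ 2)) :
    (w₁ = 0 ∨ w₁ = 1 ∨ w₁ = -1) ∧ (w₀ = 0 ∨ w₀ = 1 ∨ w₀ = -1) := by
  obtain ⟨n, hn⟩ : ∃ n, n = f.natDegree := ⟨_, rfl⟩
  have hf0 : f ≠ 0 := by rintro rfl; simp at hf
  have hL := HasLead.of_ne_zero hf0
  obtain ⟨l, hl⟩ : ∃ l, l = f.leadingCoeff := ⟨_, rfl⟩
  rw [← hn, ← hl] at hL
  rw [← hn] at hf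
  have hL2 : HasLead (f ^ 2) (n + n) (l * l) := by rw [sq]; exact hL.mul hL
  have hll := hL2.1
  have hX2 : HasLead (X ^ 2 * f ^ 2) (1 + 1 + (n + n)) (l * l) := by
    have := (HasLead.X_one.mul HasLead.X_one).mul hL2
    rw [← sq] at this
    simpa using this
  have hbf : (1 + C b * f).natDegree ≤ n := by
    refine natDegree_add_le_of_degree_le (by simp) ?_
    exact (natDegree_C_mul_le _ _).trans hL.2.2
  have hz : w₁ ≠ 0 → HasLead (1 + C b * f + (C w₁ * X + C w₀) * f ^ 2) (1 + (n + n))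
      (w₁ * (l * l)) := by
    intro hw
    rw [add_comm]
    exact ((HasLead.linear hw w₀).mul hL2).add_lower (by omega)
  have hw1 : w₁ = 0 ∨ w₁ = 1 ∨ w₁ = -1 := by
    by_cases hw : w₁ = 0
    · exact Or.inl hw
    · exact Or.inr (Int.eq_of_mul_dvd_self hll (h.swap.lead_dvd hX2 (hz hw) (by omega)))
  refine ⟨hw1, ?_⟩
  by_cases hw : w₀ = 0
  · exact Or.inl hw
  right
  by_cases hw' : w₁ = 0
  · subst hw'
    have : HasLead (1 + C b * f + (C 0 * X + C w₀) * f ^ 2) (0 + (n + n)) (w₀ * (l * l)) := by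
      rw [add_comm, map_zero, zero_mul, zero_add]
      exact ((HasLead.const hw).mul hL2).add_lower (by omega)
    exact Int.eq_of_mul_dvd_self hll (h.swap.lead_dvd hX2 this (by omega))
  · have hsq : w₁ * w₁ = 1 := by rcases hw1 with h | rfl | rfl <;> simp_all
    have hsqC : (C w₁ : ℤ[X]) * C w₁ = 1 := by rw [← map_mul, hsq, map_one]
    have h3 := h.congr_right (q' := C (w₀ * w₀) * f ^ 2 + -((C w₁ * X + C (-w₀)) * (1 + C b * f)))
      ⟨-(C w₁ * X - C w₀), by
        simp only [map_mul, map_neg]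
        linear_combination (X ^ 2 * f ^ 2) * hsqC⟩
    have h4 : HasLead (C (w₀ * w₀) * f ^ 2 + -((C w₁ * X + C (-w₀)) * (1 + C b * f)))
        (0 + (n + n)) (w₀ * w₀ * (l * l)) := by
      refine ((HasLead.const (mul_ne_zero hw hw)).mul hL2).add_lower ?_
      rw [natDegree_neg]
      have := natDegree_mul_le_of_le (HasLead.linear hw' (-w₀)).2.2 hbf
      omega
    have h5 := h3.lead_dvd (hz hw') h4 (by omega)
    have h6 : w₀ * w₀ * (l * l) ∣ l * l := by
      have := h5.mul_left w₁
      rwa [← mul_assoc w₁, hsq, one_mul] at this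
    rcases Int.eq_of_mul_dvd_self hll h6 with h | h
    · exact Int.isUnit_iff.mp (IsUnit.of_mul_eq_one _ h)
    · nlinarith [mul_self_nonneg w₀]

/-- At x = 0 the numerator with N = 2 is f(0)f(f(0)) = f(1). -/
theorem eval_one_of_isSpecPair (hf0 : f.eval 0 = 1) (hfd : f ∣ f.comp f - 1) (he : f.eval 1 ≠ 0)
    (h2 : IsSpecPair ((X + f) * f.comp f + X * f) (X * f * f.comp f)) :
    f.eval 1 = 1 ∨ f.eval 1 = -1 := by
  have := h2.eval_zero_eq (by simpa [hf0] using he) (by simp) fun π hπ hπX h1 h2 => by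
    have key : ¬ π ∣ f := by
      intro h
      have h3 : π ∣ X * f.comp f := by
        have h4 : π ∣ f * f.comp f + X * f :=
          dvd_add (h.mul_right _) (h.mul_left _)
        have := dvd_sub h1 h4
        convert this using 1; ring
      rcases hπ.dvd_or_dvd h3 with h4 | h4
      · exact hπX h4
      · have := dvd_sub h4 (h.trans hfd)
        rw [sub_sub_cancel] at this
        exact hπ.not_dvd_one this
    rcases hπ.dvd_or_dvd h2 with h | h
    · rcases hπ.dvd_or_dvd h with h | h
      · exact hπX h
      · exact key h
    · rcases hπ.dvd_or_dvd ((dvd_add_right (h.mul_left _)).mp h1) with h | h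
      · exact hπX h
      · exact key h
  simpa [hf0] using this

/-- With b = c + 1 and w₀ = A - 1, `hb` says f(1) = 0. The numerator is then divisible by x, and
after cancellation its value at 0 is w₁ + 2. -/
theorem slope_of_eval_one_eq_zero {k : ℤ[X]} {b w₀ w₁ : ℤ} (hf : f = 1 + X * k)
    (hk : k.eval 0 * (2 + b) = -2) (hb : 1 + b + w₀ = 0)
    (hw₁ : w₁ = 0 ∨ w₁ = 1 ∨ w₁ = -1)
    (h : IsSpecPair (1 + C b * f + (C w₁ * X + C w₀) * f ^ 2) (X ^ 2 * f ^ 2)) :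
    w₁ = -1 := by
  have hw₀ : (C w₀ : ℤ[X]) = -1 - C b := by
    rw [show w₀ = -1 - b by omega]; simp
  have h1 : IsSpecPair (C w₁ * f ^ 2 - k * (1 + (1 + C b) * f)) (X * f ^ 2) := by
    refine IsSpecPair.cancel X_ne_zero ?_
    convert h using 1
    · rw [hw₀]
      linear_combination (1 + (1 + C b) * f) * hf
    · ring
  have hev : (C w₁ * f ^ 2 - k * (1 + (1 + C b) * f)).eval 0 = w₁ + 2 := by
    rw [hf]
    simp
    linear_combination -hk
  have := h1.eval_zero_eq (by rw [hev]; omega) (by simp) fun π hπ hπX h1 h2 => by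
    rcases hπ.dvd_or_dvd h2 with h | h
    · exact hπX h
    · have h := hπ.dvd_of_dvd_pow h
      have h3 : π ∣ k := by
        have h4 : π ∣ C w₁ * f ^ 2 - k * (1 + C b) * f :=
          dvd_sub ((h.pow two_ne_zero).mul_left _) (h.mul_left _)
        have := dvd_sub h4 h1
        convert this using 1; ring
      have := dvd_sub h (h3.mul_left X)
      rw [hf, add_sub_cancel_right] at this
      exact hπ.not_dvd_one this
  rw [hev] at this
  omega

/-- Divisions using w₁² = e² = 1 bring the leading coefficient down to 2 - w₁ times that of 1 - f,
which forces w₁ = 1. If e = -1, one further division produces the factor 9 = x² - (x + 3)(x - 3),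
which is impossible. -/
theorem slope_of_eval_one_eq_one {g : ℤ[X]} {e w₁ : ℤ} (hf : f = 1 + C (-2) * X + X ^ 2 * g)
    (hdeg : 1 < f.natDegree) (he : e = 1 ∨ e = -1) (hw : w₁ = 1 ∨ w₁ = -1)
    (h : IsSpecPair (1 + C (-1) * f + (C w₁ * X + C e) * f ^ 2) (X ^ 2 * f ^ 2)) :
    w₁ = 1 ∧ e = 1 := by
  obtain ⟨n, hn⟩ : ∃ n, n = f.natDegree := ⟨_, rfl⟩
  have hf0 : f ≠ 0 := by rintro rfl; simp at hdeg
  have hL := HasLead.of_ne_zero hf0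
  obtain ⟨l, hl⟩ : ∃ l, l = f.leadingCoeff := ⟨_, rfl⟩
  rw [← hn, ← hl] at hL
  rw [← hn] at hdeg
  have hF : HasLead (1 - f) n (-l) := by
    rw [sub_eq_neg_add]; exact hL.neg.add_lower (by simp; omega)
  have hX2 : HasLead (X ^ 2 * (1 - f)) (1 + 1 + n) (1 * 1 * -l) := by
    have := (HasLead.X_one.mul HasLead.X_one).mul hF
    rwa [← sq] at this
  have hsqC : (C w₁ : ℤ[X]) * C w₁ = 1 := by
    rw [← map_mul]; rcases hw with rfl | rfl <;> simp
  have hsqE : (C e : ℤ[X]) * C e = 1 := by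
    rw [← map_mul]; rcases he with rfl | rfl <;> simp
  simp only [map_neg, map_ofNat, map_one] at hf h
  have h1 := h.congr_right (q' := f ^ 2 - (C w₁ * X - C e) * (1 - f))
    ⟨-(C w₁ * X - C e), by
      linear_combination (X ^ 2 * f ^ 2) * hsqC - f ^ 2 * hsqE⟩
  have h2 := h1.congr_left (p' := X ^ 2 * (1 - f))
    ⟨-(C w₁ * X + C e), by
      linear_combination (-(X ^ 2 * (1 - f))) * hsqC + (1 - f) * hsqE⟩
  have h3 : IsSpecPair (X ^ 2 * (1 - f)) ((C (2 - w₁) * X + C (e - 2)) * (1 - f) + 1) :=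
    h2.congr_right ⟨g, by
      simp only [map_sub, map_ofNat]
      linear_combination (1 - f) * hf⟩
  have hlin : HasLead ((C (2 - w₁) * X + C (e - 2)) * (1 - f) + 1) (1 + n) ((2 - w₁) * -l) :=
    ((HasLead.linear (by omega) _).mul hF).add_lower (by simp)
  have hw1 : w₁ = 1 := by
    have := h3.lead_dvd hX2 hlin (by omega)
    rw [one_mul, one_mul] at this
    have := Int.eq_of_mul_dvd_self hF.1 this
    omega
  refine ⟨hw1, ?_⟩
  subst hw1
  rcases he with he | rfl
  · exact he
  · exfalso
    have h4 : IsSpecPair (C 9 * (1 - f) + -(X + 3))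
        ((C (2 - 1) * X + C (-1 - 2)) * (1 - f) + 1) :=
      h3.congr_left ⟨-(X + 3), by
        simp only [map_sub, map_neg, map_one, map_ofNat]; ring⟩
    have h5 : HasLead (C 9 * (1 - f) + -(X + 3)) (0 + n) (9 * -l) :=
      ((HasLead.const (by norm_num)).mul hF).add_lower (by
        rw [natDegree_neg]
        have : (X + 3 : ℤ[X]).natDegree = 1 := by
          simpa using natDegree_X_add_C (3 : ℤ)
        omega)
    have := h4.swap.lead_dvd hlin h5 (by omega)
    rw [show (2 - 1) * -l = -l by ring] at this
    have := Int.eq_of_mul_dvd_self hF.1 this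
    omega

/-- This residue passes the tests for N = 1 and N = 2. For N = 3, undoing two matrices leaves a
remainder with leading factor -2x + 1, and -2 is not a unit. -/
theorem not_isSpecPair_three
    (hf : f = 1 - X + X ^ 2 * (X + (X - 1) ^ 2 * κ)) (hdeg : 1 < f.natDegree)
    (h1 : IsSpecPair (X + f) (X * f))
    (h3 : IsSpecPair (((X + f) * f.comp f + X * f) * f.comp (f.comp f) + X * f * f.comp f)
      (X * f * f.comp f * f.comp (f.comp f))) : False := by
  have hY : f.comp f = 1 - f + f ^ 2 * (f + (f - 1) ^ 2 * κ.comp f) := by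
    simpa using congrArg (fun p => p.comp f) hf
  have hZ : f.comp (f.comp f) = 1 - f.comp f + (f.comp f) ^ 2 *
      (f.comp f + (f.comp f - 1) ^ 2 * κ.comp (f.comp f)) := by
    simpa using congrArg (fun p => p.comp (f.comp f)) hf
  have hYdeg : (f.comp f).natDegree = f.natDegree * f.natDegree := natDegree_comp
  generalize f.comp (f.comp f) = Z at *
  generalize κ.comp f = κ₁ at *
  generalize f.comp f = Y at *
  generalize κ.comp Y = κ₂ at *
  obtain ⟨g, hg⟩ : ∃ g, g = X + (X - 1) ^ 2 * κ := ⟨_, rfl⟩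
  rw [← hg] at hf
  have hk : f - 1 = X * (X * g - 1) := by rw [hf]; ring
  obtain ⟨l, hl⟩ : ∃ l, l = g + (X * g - 1) ^ 2 * κ₁ := ⟨_, rfl⟩
  have hY' : Y = 1 - f + f ^ 2 * (1 - X + X ^ 2 * l) := by
    rw [hY, hl]
    linear_combination (f ^ 2 + f ^ 2 * κ₁ * (f - 1 + X * (X * g - 1))) * hk
  have hd : (X + f) * (1 - X * g) - (-g) * (X * f) = 1 := by rw [hf]; ring
  obtain ⟨θ, hθ⟩ : ∃ θ, Y - 1 = X * f * θ :=
    ⟨-1 + X * l + (X * g - 1) * (1 - X + X ^ 2 * l), by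
      linear_combination hY' + f * (1 - X + X ^ 2 * l) * hk⟩
  have h4 := IsSpecPair.mul_inv (h1.isElemPair hd) hd h3
  have h5 : IsSpecPair ((Z + Y) * (1 - X * f ^ 2) - Y ^ 2) (-(X ^ 2 * f ^ 2 * (Z + Y))) := by
    have h : IsSpecPair (Z * Y + f * (1 - f) * (Z + Y)) (-(X ^ 2 * f ^ 2 * (Z + Y))) := by
      convert h4 using 1
      · linear_combination (-Z * Y) * hd - f * (Z + Y) * hk
      · ring
    exact h.congr_left ⟨l, by linear_combination (-(Z + Y)) * hY'⟩
  have hd' : (1 - X * f ^ 2) * (1 + X * f ^ 2) - f ^ 2 * (-(X ^ 2 * f ^ 2)) = 1 := by ring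
  have hE : IsElemPair (1 - X * f ^ 2) (-(X ^ 2 * f ^ 2)) := by
    have := ((IsElemPair.one_left (X : ℤ[X])).neg_left.fold (f ^ 2)).neg_right
    convert this using 1 <;> ring
  have h6 := IsSpecPair.mul_inv hE hd' h5
  have h7 : IsSpecPair ((C (-2) * X + C 1) * (f ^ 2 * Y ^ 2) + (1 - f * Y ^ 2))
      (X ^ 2 * (f ^ 2 * Y ^ 2)) := by
    have h : IsSpecPair (Z + Y - (1 + X * f ^ 2) * Y ^ 2) (X ^ 2 * (f ^ 2 * Y ^ 2)) := by
      convert h6.neg_right using 1 <;> ring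
    refine h.congr_left ⟨-(l + θ ^ 2 * κ₂), ?_⟩
    simp only [map_neg, map_ofNat, map_one]
    linear_combination (-1 : ℤ[X]) * hZ - Y ^ 2 * hY' - Y ^ 2 * κ₂ * (Y - 1 + X * f * θ) * hθ
  obtain ⟨n, hn⟩ : ∃ n, n = f.natDegree := ⟨_, rfl⟩
  obtain ⟨m, hm⟩ : ∃ m, m = Y.natDegree := ⟨_, rfl⟩
  have hf0 : f ≠ 0 := by rintro rfl; simp at hdeg
  have hY0 : Y ≠ 0 := by
    rintro rfl
    rw [natDegree_zero] at hYdeg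
    nlinarith
  have hL := HasLead.of_ne_zero hf0
  have hM := HasLead.of_ne_zero hY0
  rw [← hn] at hL hdeg
  rw [← hm] at hM
  have hM2 := hM.mul hM
  have hfY := (hL.mul hL).mul hM2
  rw [← sq, ← sq] at hfY
  have hX2 := (HasLead.X_one.mul HasLead.X_one).mul hfY
  rw [← sq] at hX2
  have hlow : (1 - f * Y ^ 2).natDegree ≤ n + (m + m) := by
    refine (natDegree_sub_le _ _).trans (max_le (by simp) ?_)
    rw [sq]
    exact natDegree_mul_le_of_le hL.2.2 hM2.2.2
  have hlead := ((HasLead.linear (a := -2) (by norm_num) 1).mul hfY).add_lower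
    (q := 1 - f * Y ^ 2) (by omega)
  have := h7.swap.lead_dvd hX2 hlead (by omega)
  rw [one_mul, one_mul] at this
  have := Int.eq_of_mul_dvd_self hfY.1 this
  omega

/-- The remainders of `f` that allow specializable continued fractions when `f(0) = 1`. -/
theorem necessity_one (hdeg : 1 < f.natDegree) (hf0 : f.eval 0 = 1)
    (h1 : IsSpecPair (X + f) (X * f))
    (h2 : IsSpecPair ((X + f) * f.comp f + X * f) (X * f * f.comp f))
    (h3 : IsSpecPair (((X + f) * f.comp f + X * f) * f.comp (f.comp f) + X * f * f.comp f)
      (X * f * f.comp f * f.comp (f.comp f))) :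
    X ^ 2 * (X - 1) ∣ f - 1 ∨
    ∃ r ∈ ([X ^ 3 - X ^ 2 - X + 1, -X ^ 3 + 2 * X ^ 2 - X + 1, -X ^ 3 + 3 * X ^ 2 - 2 * X + 1,
      X ^ 2 - X + 1, X ^ 2 - 2 * X + 1] : List ℤ[X]), X ^ 2 * (X - 1) ^ 2 ∣ f - r := by
  -- Dividing twice by x and twice by x - 1 gives coordinates c, A, G for f modulo x²(x - 1)²; here
  -- f(1) = 1 + c + A.
  obtain ⟨k₁, hk₁⟩ : X - C 0 ∣ f - C (f.eval 0) := X_sub_C_dvd_sub_C_eval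
  rw [hf0, map_zero, sub_zero] at hk₁
  obtain ⟨k₂, hk₂⟩ : X - C 0 ∣ k₁ - C (k₁.eval 0) := X_sub_C_dvd_sub_C_eval
  rw [map_zero, sub_zero] at hk₂
  obtain ⟨k₃, hk₃⟩ : X - C 1 ∣ k₂ - C (k₂.eval 1) := X_sub_C_dvd_sub_C_eval
  obtain ⟨κ, hκ⟩ : X - C 1 ∣ k₃ - C (k₃.eval 1) := X_sub_C_dvd_sub_C_eval
  generalize k₁.eval 0 = c at *
  generalize k₂.eval 1 = A at *
  generalize k₃.eval 1 = G at *
  have hf : f = 1 + C c * X + X ^ 2 * (C A + C G * (X - 1) + (X - 1) ^ 2 * κ) := by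
    rw [map_one] at hk₁ hk₃ hκ
    linear_combination hk₁ + X * hk₂ + X ^ 2 * hk₃ + X ^ 2 * (X - 1) * hκ
  clear hk₁ hk₂ hk₃ hκ
  have hc := linear_coeff_of_isSpecPair hf h1
  have hS := isSpecPair_two hf h1 h2
  obtain ⟨hw₁, hw₀⟩ := bounds_of_isSpecPair hdeg hS
  have he : f.eval 1 = 1 + c + A := by rw [hf]; simp
  have hfd : f ∣ f.comp f - 1 := by
    have : f.comp f = 1 + C c * f + f ^ 2 * (C A + C G * (f - 1) + (f - 1) ^ 2 * κ.comp f) := by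
      simpa using congrArg (fun p => p.comp f) hf
    exact ⟨C c + f * (C A + C G * (f - 1) + (f - 1) ^ 2 * κ.comp f), by rw [this]; ring⟩
  have hev : 1 + c + A = 0 ∨ 1 + c + A = 1 ∨ 1 + c + A = -1 := by
    by_cases h : f.eval 1 = 0
    · left; rwa [he] at h
    · have := eval_one_of_isSpecPair hf0 hfd h h2
      rw [he] at this
      exact Or.inr this
  have hz : 1 + c + A = 0 → c ≠ 0 → G * c + 1 + c = -1 := by
    intro h0 hc0
    refine slope_of_eval_one_eq_zero (k := C c + X * (C A + C G * (X - 1) + (X - 1) ^ 2 * κ))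
      (by rw [hf]; ring) ?_ (by omega) hw₁ hS
    simp
    rcases hc with rfl | rfl | rfl <;> simp_all
  rcases hc with rfl | rfl | rfl
  · left
    have : A = 0 := by omega
    subst this
    refine ⟨C G + (X - 1) * κ, ?_⟩
    rw [hf]; simp only [map_zero]; ring
  · right
    have hA : A = 0 ∨ A = 1 := by omega
    rcases hA with rfl | rfl
    · have hG : G = 1 := by have := hz (by omega) (by omega); omega
      subst hG
      refine ⟨X ^ 3 - X ^ 2 - X + 1, by simp, κ, ?_⟩
      rw [hf]; simp only [map_zero, map_one, map_neg]; ring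
    · have hG : G = 1 ∨ G = 0 ∨ G = -1 := by omega
      rcases hG with rfl | rfl | rfl
      · exfalso
        refine not_isSpecPair_three (κ := κ) ?_ hdeg h1 h3
        rw [hf]; simp only [map_one, map_neg]; ring
      · refine ⟨X ^ 2 - X + 1, by simp, κ, ?_⟩
        rw [hf]; simp only [map_zero, map_one, map_neg]; ring
      · refine ⟨-X ^ 3 + 2 * X ^ 2 - X + 1, by simp, κ, ?_⟩
        rw [hf]; simp only [map_one, map_neg]; ring
  · right
    by_cases hA : A = 1
    · subst hA
      have hG : G = 0 := by have := hz (by omega) (by omega); omega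
      subst hG
      refine ⟨X ^ 2 - 2 * X + 1, by simp, κ, ?_⟩
      rw [hf]; simp only [map_zero, map_one, map_neg, map_ofNat]; ring
    · obtain ⟨h, h'⟩ := slope_of_eval_one_eq_one (e := A - 1) hf hdeg (by omega)
        (w₁ := G * -2 + 1 + -2) (by omega) hS
      have hA : A = 2 := by omega
      have hG : G = -1 := by omega
      subst hA hG
      refine ⟨-X ^ 3 + 3 * X ^ 2 - 2 * X + 1, by simp, κ, ?_⟩
      rw [hf]; simp only [map_one, map_neg, map_ofNat]; ring

end ZeroToOne

/-! ### Sufficiency -/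

/-! ### Identities for sums P/c + S/b split by the parity of the index -/

section Identities

variable {R : Type*} [CommRing R]

/-- The modular inverse of the numerator of `P / c + S / b`. -/
theorem det_add_frac {a b c k m P' P S ρ : R} (hc : c = a ^ 2 * m) (hP : P = 1 + P' * a * m)
    (hck : c = 1 - b * k) (hS : (S - 1) ^ 2 = ρ * b) :
    (P * b + S * c) * ((2 - S) * c + k ^ 2 * b * (2 - P)) -
      (P * (2 - S) + S * k ^ 2 * (2 - P) - 2 * k - P' ^ 2 * m * k ^ 2 * b - ρ * c) * (b * c)
      = 1 := by
  have h1 : (P - 1) ^ 2 = P' ^ 2 * m * c := by rw [hP, hc]; ring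
  linear_combination (-(b * k) ^ 2) * h1 - c ^ 2 * hS + (1 + c + b * k) * hck

/-- Both k - 1 being a multiple of a and (P - 1)a = P'c being a multiple of c enter here. -/
theorem sub_one_mul_eq {a b c k k' m P' P : R} (hc : c = a ^ 2 * m) (hP : P = 1 + P' * a * m)
    (hb : b = 1 - a * k') (hck : c = 1 - b * k) :
    (P - 1) * (k - b - k * c) = b * c * (P' * (k' * k - a * m) * (k + 1)) := by
  have h1 : k - 1 = a * (k' * k - a * m) := by linear_combination hck - hc - k * hb
  have h2 : k - b - k * c = b * (k - 1) * (k + 1) := by linear_combination (-k) * hck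
  have h3 : (P - 1) * a = P' * c := by rw [hP, hc]; ring
  rw [h2, h1]
  linear_combination (b * (k' * k - a * m) * (k + 1)) * h3

/-- The residue of the partial quotient that extends `P / c + S / b` by `1 / (b ^ 2 * n)`. -/
theorem dvd_residue {a b c k k' l m n h P' P S δ : R} (hc : c = a ^ 2 * m)
    (hP : P = 1 + P' * a * m) (hb : b = 1 - a * k') (hck : c = 1 - b * k)
    (hn : n = k ^ 2 * (1 + δ * c + c ^ 2 * h)) (hk : 2 - k - δ * k = b * l) :
    b * c ^ 2 ∣ b * n + ((2 - S) * c + k ^ 2 * b * (2 - P)) * c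
      - (k * (1 + δ * c) - c * a * m * (P' * b + S * a)) := by
  refine ⟨k ^ 2 * h - P' * (k' * k - a * m) * (k + 1) + l, ?_⟩
  have h1 := sub_one_mul_eq hc hP hb hck
  linear_combination b * hn - b * c * hP - c * S * hc +
    (k * (1 + δ * c) + k * c * (2 - P)) * hck - c * h1 + c ^ 2 * hk

/-- The last step of adding `1 / (b ^ 2 * n)` to `P / c + S / b`. -/
theorem IsElemPair.add_of_residue {a b c k k' l m n h P' P S δ ρ u' v' : R} (hc : c = a ^ 2 * m)
    (hP : P = 1 + P' * a * m) (hb : b = 1 - a * k') (hck : c = 1 - b * k)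
    (hn : n = k ^ 2 * (1 + δ * c + c ^ 2 * h)) (hk : 2 - k - δ * k = b * l)
    (hS : (S - 1) ^ 2 = ρ * b)
    (h1 : IsElemPair (P' * b + S * a) (a * b))
    (hd' : (P' * b + S * a) * v' - u' * (a * b) = 1)
    (h2 : IsElemPair (P * b + S * c) (b * c))
    (h3 : IsElemPair (v' * (k * (1 + δ * c)) - c * a * m) (a * b * (k * (1 + δ * c)))) :
    IsElemPair ((1 + S * b * n) * c + P * (b ^ 2 * n)) (c * (b ^ 2 * n)) := by
  have h4 := h1.of_det_mul hd' h3.neg_right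
  have h5 : IsElemPair (k * (1 + δ * c) - c * a * m * (P' * b + S * a)) (b * c ^ 2) := by
    rw [← neg_right_iff]
    convert h4 using 1
    · linear_combination (-k * (1 + δ * c)) * hd'
    · linear_combination (-b * c) * hc
  have h6 := h5.congr_left (dvd_residue (S := S) hc hP hb hck hn hk)
  have h7 := h2.of_det_mul (det_add_frac hc hP hck hS) (h6.neg_right)
  have hd := det_add_frac hc hP hck hS
  convert h7 using 1
  · linear_combination (-c) * hd
  · ring

/-- The pair left over by `add_of_residue` comes from two earlier sums. Modulo bc, the inverse
numerator of P/c + S/b is congruent to k - (P'b + Sa)am, and the inverse matrix of the sum P'/a +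
S/b carries this to the required column. -/
theorem IsElemPair.add_double {a b c k k' l m n h P' P S ρ : R} (hc : c = a ^ 2 * m)
    (hP : P = 1 + P' * a * m) (hb : b = 1 - a * k') (hck : c = 1 - b * k)
    (hn : n = k ^ 2 * (1 + c ^ 2 * h)) (hk : 2 - k = b * l)
    (hS : (S - 1) ^ 2 = ρ * b)
    (h1 : IsElemPair (P' * b + S * a) (a * b))
    (h2 : IsElemPair (P * b + S * c) (b * c)) :
    IsElemPair ((1 + S * b * n) * c + P * (b ^ 2 * n)) (c * (b ^ 2 * n)) := by
  obtain ⟨u', v', -, hd'⟩ := h1.exists_det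
  refine h1.add_of_residue (δ := 0) (h := h) hc hP hb hck (by simpa using hn) (by simpa using hk)
    hS hd' h2 ?_
  have hE := h2.inverse (det_add_frac hc hP hck hS)
  have h3 : IsElemPair (k - (P' * b + S * a) * (a * m)) (b * c) := by
    refine hE.congr_left ⟨P' * (k' * k - a * m) * (k + 1) - l, ?_⟩
    have h0 := sub_one_mul_eq hc hP hb hck
    linear_combination h0 + b * hP + S * hc - c * hk - k * (2 - P) * hck
  have h4 := (h1.inverse hd').of_det_mul
    (u := u') (v := P' * b + S * a) (by linear_combination hd') h3
  have h5 : IsElemPair (v' * k - a * m) (a * b * k) := by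
    convert h4 using 1
    · linear_combination (a * m) * hd' - u' * b * hc
    · linear_combination (-(P' * b + S * a) * b) * hc
  simp only [zero_mul, add_zero, mul_one]
  exact h5.congr_left ⟨m, by linear_combination (-a * m) * hck⟩

/-- The extra term c in n spoils the argument of `add_double`. Instead v a + b, with v the inverse
numerator of P'/a + S/b, is congruent modulo ba² to a fold of the still earlier sum T/e + Pd/d, and
its inverse there is g. -/
theorem IsElemPair.add_single [IsDomain R] {a b c d e k k' kd l l' m md me n h T Pd P' P S
    : R} (ha0 : a ≠ 0)
    (ha : a = e ^ 2 * me) (hP' : P' = 1 + T * e * me)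
    (hbd : b = d ^ 2 * md) (hS : S = 1 + Pd * d * md)
    (hc : c = a ^ 2 * m) (hP : P = 1 + P' * a * m)
    (had : a = 1 - d * kd) (hb : b = 1 - a * k') (hck : c = 1 - b * k)
    (hk' : k' = 1 + a * l') (hk : k = 1 + b * l)
    (hn : n = k ^ 2 * (1 + c + c ^ 2 * h))
    (h0 : IsElemPair (T * d + Pd * e) (e * d))
    (h1 : IsElemPair (P' * b + S * a) (a * b))
    (h2 : IsElemPair (P * b + S * c) (b * c)) :
    IsElemPair ((1 + S * b * n) * c + P * (b ^ 2 * n)) (c * (b ^ 2 * n)) := by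
  obtain ⟨u, v, -, hd⟩ := h1.exists_det
  have hSb : (S - 1) ^ 2 = Pd ^ 2 * md * b := by rw [hS, hbd]; ring
  have hPa : (P' - 1) ^ 2 = T ^ 2 * me * a := by rw [hP', ha]; ring
  refine h1.add_of_residue (δ := 1) (h := h) (l := -2 * l) hc hP hb hck (by rw [hn]; ring)
    (by rw [hk]; ring) hSb hd h2 ?_
  obtain ⟨g, hg⟩ : ∃ g, g = k * (1 + 1 * c) - a * v := ⟨_, rfl⟩
  -- Both congruences modulo ba² are checked separately modulo b and modulo a².
  have hcop : IsCoprime b (a ^ 2) :=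
    IsCoprime.pow_right ⟨1, k', by rw [hb]; ring⟩
  -- the residue of `v` modulo `b` and modulo `a`
  obtain ⟨w, hw⟩ : b ∣ a * v - (2 - S) :=
    ⟨(2 - S) * (u * a - P' * v) + Pd ^ 2 * md * a * v, by
      linear_combination (2 - S) * hd + a * v * hSb⟩
  obtain ⟨x, hx⟩ : a ∣ v - (2 - P') :=
    ⟨(2 - P') * (u * b - S * v + P' * k' * v) + T ^ 2 * me * v, by
      linear_combination (2 - P') * hd + v * hPa - (2 - P') * P' * v * hb⟩
  have hk₁ : k - 1 = a * (k' * k - a * m) := by linear_combination hck - hc - k * hb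
  have hb₂ : b = 1 - a - a ^ 2 * l' := by linear_combination hb - a * hk'
  have hkc : k * (1 + 1 * c) = 2 + b * (2 * l - k - b * l * k) := by
    linear_combination k * hck + (2 - b * k) * hk
  have hk₂ : k * (1 + 1 * c) = 1 + a + a ^ 2 * (k' * (k' * k - a * m) + l' - m + k * m) := by
    linear_combination (1 + a * k') * hk₁ + k * hc + a * hk'
  generalize k' * (k' * k - a * m) + l' - m + k * m = σ at hk₂
  have hD : b * a ^ 2 ∣ (v * a + b) * g - 1 := by
    refine hcop.mul_dvd ?_ ?_
    · refine ⟨g + (2 * l - k - b * l * k) * (v * a) -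
        (Pd ^ 2 * md + 2 * (1 - S) * w + b * w ^ 2), ?_⟩
      rw [hg]
      linear_combination v * a * hkc - (a * v - S + b * w) * hw - hSb
    · refine ⟨σ * (1 + a * v - a) - l' * (1 - a * v + a) - a ^ 2 * l' * σ - (v - 1) ^ 2, ?_⟩
      rw [hg, hk₂]
      linear_combination (1 + a + a ^ 2 * σ - a * v) * hb₂
  have hC : b * a ^ 2 ∣ (v * a + b) - (1 + -(a * me * md) * (e * d) * (T * d + Pd * e)) := by
    have hZ : a * me * md * (e * d) * (T * d + Pd * e) = a * (P' - 1) * b + a ^ 2 * (S - 1) := by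
      rw [hP', hS]
      linear_combination (-(a * T * e * me)) * hbd - (a * Pd * d * md) * ha
    have hS₁ : (a - 1) * (S - 1) = -(kd * Pd * b) := by
      rw [hS]
      linear_combination Pd * d * md * had + kd * Pd * hbd
    refine hcop.mul_dvd ?_ ?_
    · refine ⟨w + 1 + a * (P' - 1) - (a + 1) * kd * Pd, ?_⟩
      linear_combination hw + (a + 1) * hS₁ + hZ
    · refine ⟨x - l' - k' * (P' - 1) + S - 1, ?_⟩
      linear_combination a * hx + hb₂ + a * (P' - 1) * hb + hZ
  obtain ⟨μ, hμ⟩ := hD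
  have hE : IsElemPair (v * a + b) (b * a ^ 2) := by
    refine IsElemPair.congr_left ?_ hC
    have := (h0.fold (-(a * me * md))).neg_right
    convert this using 1
    linear_combination a ^ 2 * hbd + d ^ 2 * md * a * ha
  have h3 := hE.of_det_mul (u := μ) (v := g) (by linear_combination hμ)
    (h1.inverse hd)
  convert h3 using 1
  · refine mul_left_cancel₀ ha0 ?_
    linear_combination c * hc + hμ - (v * a + b) * hg - (1 + c) * hck
  · rw [hg]; ring

end Identities

/-! ### Inductions over the partial sums -/

section Sequences

/-- All partial sums of `1 / y n` have specializable continued fractions. -/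
def SumsSpecializable (y : ℕ → ℤ[X]) : Prop :=
  ∀ N, HasSpecializableContFrac (∑ n ∈ Finset.range (N + 1), 1 / intPolyHom (y n))

variable {y : ℕ → ℤ[X]} {F : ℤ[X]}

theorem dvd_eval_comp {p q : ℤ[X]} (h : p ∣ q) (r : ℤ[X]) : p.comp r ∣ q.comp r :=
  map_dvd (compRingHom r) h

theorem sumsSpecializable_of_sq_dvd (hy : ∀ n, y (n + 1) = F.comp (y n)) (hne : ∀ n, y n ≠ 0)
    (hF : X ^ 2 ∣ F) : SumsSpecializable y := by
  have key : ∀ N, ∃ p, IsElemPair p (y N) ∧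
      ∑ n ∈ Finset.range (N + 1), 1 / intPolyHom (y n) = intPolyHom p / intPolyHom (y N) := by
    intro N
    induction N with
    | zero => exact ⟨1, .one_left _, by simp⟩
    | succ N ih =>
      obtain ⟨p, hE, hs⟩ := ih
      obtain ⟨h, hh⟩ := dvd_eval_comp hF (y N)
      simp only [pow_comp, X_comp] at hh
      have hy' : y (N + 1) = h * y N ^ 2 := by rw [hy, hh]; ring
      refine ⟨1 + h * y N * p, by rw [hy']; exact hE.fold h, ?_⟩
      have h1 := intPolyHom_ne_zero (hne N)
      have h2 := intPolyHom_ne_zero (hne (N + 1))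
      rw [Finset.sum_range_succ, hs, div_add_div _ _ h1 h2, div_eq_div_iff (mul_ne_zero h1 h2) h2]
      simp only [← map_mul, ← map_add, ← map_one intPolyHom]
      congr 1
      rw [hy']; ring
  intro N
  obtain ⟨p, hE, hs⟩ := key N
  rw [hs]
  exact hE.hasSpecializableContFrac (hne N)

/-- The iterate factors as qq', where q and q' are denominators in a matrix of determinant one. The
next term is then the difference of two consecutive convergents, so adding it moves to the next
convergent. -/
theorem sumsSpecializable_of_sq_dvd_add (hy : ∀ n, y (n + 1) = F.comp (y n))
    (hne : ∀ n, y n ≠ 0) (hF : X ^ 2 ∣ F + X) : SumsSpecializable y := by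
  have key : ∀ N, ∃ p q p' q', IsElemPair p q ∧ p * q' - p' * q = 1 ∧ q * q' = y N ∧
      ∑ n ∈ Finset.range (N + 1), 1 / intPolyHom (y n) = intPolyHom p / intPolyHom q := by
    intro N
    induction N with
    | zero => exact ⟨1, y 0, 0, 1, .one_left _, by ring, by ring, by simp⟩
    | succ N ih =>
      obtain ⟨p, q, p', q', hE, hd, hq, hs⟩ := ih
      obtain ⟨h, hh⟩ := dvd_eval_comp hF (y N)
      simp only [pow_comp, X_comp, add_comp] at hh
      have hy' : (q' ^ 2 * h * q - q') * q = y (N + 1) := by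
        rw [hy]
        linear_combination (-1 + h * (y N + q * q')) * hq - hh
      have h1 : (q' ^ 2 * h * q - q') ≠ 0 := left_ne_zero_of_mul (hy' ▸ hne (N + 1))
      have h2 : q ≠ 0 := right_ne_zero_of_mul (hy' ▸ hne (N + 1))
      refine ⟨q' ^ 2 * h * p - p', q' ^ 2 * h * q - q', p, q, ?_, by linear_combination hd,
        hy', ?_⟩
      · have := hE.of_det_mul hd (IsElemPair.one_right (q' ^ 2 * h)).neg_right
        convert this using 1 <;> ring
      · have h1' := intPolyHom_ne_zero h1
        have h2' := intPolyHom_ne_zero h2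
        rw [Finset.sum_range_succ, hs, ← hy', map_mul, div_add_div _ _ h2' (mul_ne_zero h1' h2'),
          div_eq_div_iff (mul_ne_zero h2' (mul_ne_zero h1' h2')) h1']
        simp only [← map_mul, ← map_add, ← map_one intPolyHom]
        congr 1
        linear_combination (-(q' ^ 2 * h * q - q') * q) * hd
  intro N
  obtain ⟨p, q, p', q', hE, -, hq, hs⟩ := key N
  rw [hs]
  exact hE.hasSpecializableContFrac (left_ne_zero_of_mul (hq ▸ hne N))

theorem intPolyHom_div_add {p q r : ℤ[X]} (hq : q ≠ 0) (hr : r ≠ 0) :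
    intPolyHom p / intPolyHom q + 1 / intPolyHom r
      = intPolyHom (p * r + 1 * q) / intPolyHom (q * r) := by
  have h1 := intPolyHom_ne_zero hq
  have h2 := intPolyHom_ne_zero hr
  rw [div_add_div _ _ h1 h2]
  simp only [map_mul, map_add, map_one]
  ring

/-- The invariant says that the next iterate is 1 - jvq modulo q², with v inverse to p modulo q.
Adding its reciprocal needs 1 + (1 - j)vq to be elementary against q²; for j = 0, 1, 2 this is a
fold with t = 1, a trivial pair, or a fold with t = -1. -/
theorem sumsSpecializable_of_dvd_sub_one {w j : ℤ[X]} (hy : ∀ n, y (n + 1) = F.comp (y n))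
    (hne : ∀ n, y n ≠ 0) (hF : F - 1 = X * (X - 1) * w) (hj : j = 0 ∨ j = 1 ∨ j = 2)
    (hw : X ∣ w - j) (hw' : X - 1 ∣ j * (w - 1)) : SumsSpecializable y := by
  have hjc : ∀ r, j.comp r = j := by rcases hj with rfl | rfl | rfl <;> simp
  have hFr : ∀ n, y (n + 1) - 1 = y n * (y n - 1) * w.comp (y n) := by
    intro n
    have := congrArg (fun p => p.comp (y n)) hF
    simpa [hy] using this
  have hwr : ∀ n, ∃ x, w.comp (y n) - j = y n * x := by
    intro n
    obtain ⟨x, hx⟩ := dvd_eval_comp hw (y n)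
    exact ⟨x, by simpa [hjc] using hx⟩
  have hwr' : ∀ n, ∃ x, j * (w.comp (y n) - 1) = (y n - 1) * x := by
    intro n
    obtain ⟨x, hx⟩ := dvd_eval_comp hw' (y n)
    exact ⟨x, by simpa [hjc] using hx⟩
  have key : ∀ N, ∃ p q, IsElemPair p q ∧ q ≠ 0 ∧ q ^ 2 ∣ p * (y (N + 1) - 1) + j * q ∧
      ∑ n ∈ Finset.range (N + 1), 1 / intPolyHom (y n) = intPolyHom p / intPolyHom q := by
    intro N
    induction N with
    | zero =>
      refine ⟨1, y 0, .one_left _, hne 0, ?_, by simp⟩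
      obtain ⟨x, hx⟩ := hwr 0
      exact ⟨w.comp (y 0) - x, by linear_combination hFr 0 - y 0 * hx⟩
    | succ N ih =>
      obtain ⟨p, q, hE, hq, ⟨z, hz⟩, hs⟩ := ih
      obtain ⟨u, v, -, hd⟩ := hE.exists_det
      obtain ⟨t, ht⟩ := hwr (N + 1)
      obtain ⟨t', ht'⟩ := hwr' (N + 1)
      have hFN := hFr (N + 1)
      have hyN := hne (N + 1)
      generalize w.comp (y (N + 1)) = W at *
      have hsum := intPolyHom_div_add (p := p) hq hyN
      rw [← hs, ← Finset.sum_range_succ] at hsum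
      generalize y (N + 1) = Y at *
      generalize y (N + 1 + 1) = Z at *
      obtain ⟨s, hs⟩ : q ∣ Y - 1 :=
        ⟨v * q * z - v * j - u * (Y - 1), by linear_combination v * hz - (Y - 1) * hd⟩
      refine ⟨p * Y + 1 * q, q * Y, ?_, mul_ne_zero hq hyN, ?_, hsum⟩
      · refine hE.add_frac hd ?_
        rw [one_mul, mul_one]
        have h1 : IsElemPair (1 + (1 - j) * v * q) (q ^ 2) := by
          rcases hj with rfl | rfl | rfl
          · have := hE.fold_inverse hd 1
            convert this using 1 <;> ring
          · simpa using IsElemPair.one_left (q ^ 2)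
          · have := (hE.fold_inverse hd (-1)).neg_right
            convert this using 1 <;> ring
        refine h1.congr_left ⟨v * z - u * s, ?_⟩
        linear_combination v * hz - u * q * hs - (Y - 1) * hd
      · have hcop : IsCoprime (q ^ 2) Y := IsCoprime.pow_left ⟨-s, 1, by linear_combination hs⟩
        have h2 : q ^ 2 * Y ∣ (p * Y + 1 * q) * (Y - 1) * W + j * q := by
          refine hcop.mul_dvd ?_ ?_
          · refine ⟨Y * W * z + s * W - Y * s * t' - j * s, ?_⟩
            linear_combination Y * W * hz - q * Y * ht' + (q * W - q * Y * t' - j * q) * hs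
          · refine ⟨p * (Y - 1) * W + q * W - q * t, ?_⟩
            linear_combination (-q) * ht
        obtain ⟨x, hx⟩ := h2
        exact ⟨x, by linear_combination (p * Y + 1 * q) * hFN + Y * hx⟩
  intro N
  obtain ⟨p, q, hE, hq, -, hs⟩ := key N
  rw [hs]
  exact hE.hasSpecializableContFrac hq

/-- The residue for the next term is a fold of the previous partial sum P/Q, not of the present one,
with t the square of the current iterate. The congruence is verified modulo Q² and modulo that
square. -/
theorem sumsSpecializable_of_sub_one_sq_dvd {w : ℤ[X]} (hy : ∀ n, y (n + 1) = F.comp (y n))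
    (hne : ∀ n, y n ≠ 0) (hF : F - 1 = X * (X - 1) ^ 2 * w) (hw : X ∣ w + 1) :
    SumsSpecializable y := by
  have key : ∀ N, ∃ P Q, IsElemPair P Q ∧ IsElemPair (P * y N + 1 * Q) (Q * y N) ∧ Q ≠ 0 ∧
      Q ∣ y N - 1 ∧ ∑ n ∈ Finset.range (N + 1), 1 / intPolyHom (y n)
        = intPolyHom (P * y N + 1 * Q) / intPolyHom (Q * y N) := by
    intro N
    induction N with
    | zero =>
      exact ⟨0, 1, .one_right _, by simpa using IsElemPair.one_left (y 0), one_ne_zero,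
        one_dvd _, by simp⟩
    | succ N ih =>
      obtain ⟨P, Q, hE, hE', hQ, ⟨s, hs⟩, hsum⟩ := ih
      have hyN := hne (N + 1)
      have hq := mul_ne_zero hQ (hne N)
      have hsum' := intPolyHom_div_add (p := P * y N + 1 * Q) hq hyN
      rw [← hsum, ← Finset.sum_range_succ] at hsum'
      obtain ⟨x, hx⟩ := dvd_eval_comp hw (y N)
      have hFN : y (N + 1) - 1 = y N * (y N - 1) ^ 2 * w.comp (y N) := by
        have := congrArg (fun p => p.comp (y N)) hF
        simpa [hy] using this
      simp only [add_comp, one_comp, X_comp] at hx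
      generalize w.comp (y N) = W at *
      refine ⟨_, _, hE', ?_, hq, ⟨s * (y N - 1) * W, ?_⟩, hsum'⟩
      · generalize y N = t at *
        generalize y (N + 1) = Y at *
        obtain ⟨U, V, -, hD⟩ := hE.exists_det
        obtain ⟨u, v, -, hd⟩ := hE'.exists_det
        refine hE'.add_frac hd ?_
        rw [one_mul, mul_one]
        have h1 := hE.fold_inverse hD (t ^ 2)
        rw [show t ^ 2 * Q ^ 2 = (Q * t) ^ 2 by ring] at h1
        refine h1.congr_left ?_
        rw [mul_pow]
        have hcop : IsCoprime (Q ^ 2) (t ^ 2) := IsCoprime.pow ⟨-s, 1, by linear_combination hs⟩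
        refine hcop.mul_dvd ?_ ?_
        · refine ⟨t * s ^ 2 * W - t * (t * v * U + V * v - V * u * t + s * v + s * V), ?_⟩
          linear_combination hFN + t * W * (t - 1 + Q * s) * hs
            + t * Q * (V * hd - t * v * hD - (v + V) * hs)
        · refine ⟨x * (1 - 2 * t + t ^ 2) + 2 - t + u * Q - P * v - Q * V, ?_⟩
          linear_combination hFN + t * (t - 1) ^ 2 * hx + t * hd
      · rw [hFN, hs]; ring
  intro N
  obtain ⟨p, q, -, hE, hq, -, hs⟩ := key N
  rw [hs]
  exact hE.hasSpecializableContFrac (mul_ne_zero hq (hne N))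

theorem intPolyHom_double_add {P S b c n : ℤ[X]} (hb : b ≠ 0) (hc : c ≠ 0) (hn : n ≠ 0) :
    intPolyHom (P * b + S * c) / intPolyHom (b * c) + 1 / intPolyHom (b ^ 2 * n)
      = intPolyHom ((1 + S * b * n) * c + P * (b ^ 2 * n)) / intPolyHom (c * (b ^ 2 * n)) := by
  have h1 := intPolyHom_ne_zero hb
  have h2 := intPolyHom_ne_zero hc
  have h3 := intPolyHom_ne_zero hn
  simp only [map_mul, map_add, map_one, map_pow]
  field_simp
  ring

/-- S/y_N and P/y_{N+1} are the sums over the indices of the parity of N and of N + 1. The relation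
P = 1 + P'am means P/c = 1/c + P'/a, where a is the iterate before y_N. -/
theorem sumsSpecializable_of_double {h : ℤ[X]} (hy : ∀ n, y (n + 1) = F.comp (y n))
    (hne : ∀ n, y n ≠ 0) (hF : F = (X - 1) ^ 2 * (1 + X ^ 2 * h)) : SumsSpecializable y := by
  have hFr : ∀ n, y (n + 1) = (y n - 1) ^ 2 * (1 + y n ^ 2 * h.comp (y n)) := by
    intro n
    have := congrArg (fun p => p.comp (y n)) hF
    simpa [hy] using this
  have key : ∀ N, ∃ a m P' S P k' ρ, y (N + 1) = a ^ 2 * m ∧ P = 1 + P' * a * m ∧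
      y N = 1 - a * k' ∧ (S - 1) ^ 2 = ρ * y N ∧
      IsElemPair (P' * y N + S * a) (a * y N) ∧
      IsElemPair (P * y N + S * y (N + 1)) (y N * y (N + 1)) ∧
      ∑ n ∈ Finset.range (N + 1 + 1), 1 / intPolyHom (y n)
        = intPolyHom (P * y N + S * y (N + 1)) / intPolyHom (y N * y (N + 1)) := by
    intro N
    induction N with
    | zero =>
      -- The missing iterate before y₀ is replaced by a = 1 with the empty sum P' = 0.
      refine ⟨1, y 1, 0, 1, 1, 1 - y 0, 0, by ring, by ring, by ring, by ring, ?_, ?_, ?_⟩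
      · simpa using IsElemPair.one_left (y 0)
      · have h1 := (IsElemPair.one_left (y 0)).add_frac (u := 0) (v := 1) (n := 1) (m := y 1)
          (by ring) ?_
        · convert h1 using 1
          ring
        · have h2 : IsElemPair (1 - y 0) (1 * y 0 ^ 2) := by
            have := ((IsElemPair.one_left (y 0)).fold (-1)).neg_right
            convert this using 1 <;> ring
          refine h2.congr_left ⟨1 + (y 0 - 1) ^ 2 * h.comp (y 0), ?_⟩
          linear_combination hFr 0
      · have := intPolyHom_div_add (p := 1) (hne 0) (hne 1)
        rw [Finset.sum_range_succ, Finset.sum_range_one]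
        rw [map_one] at this
        rw [this]
        congr 2
        ring
    | succ N ih =>
      obtain ⟨a, m, P', S, P, k', ρ, hc, hP, hb, hS, h1, h2, hs⟩ := ih
      have hb0 := hne N
      have hc0 := hne (N + 1)
      have hd0 := hne (N + 1 + 1)
      have hFc := hFr N
      have hFd := hFr (N + 1)
      rw [Finset.sum_range_succ, hs]
      generalize h.comp (y N) = H at *
      generalize h.comp (y (N + 1)) = H' at *
      generalize y (N + 1 + 1) = d at *
      generalize y (N + 1) = c at *
      generalize y N = b at *
      obtain ⟨l, hl⟩ : ∃ l, l = 1 + (1 - b) ^ 2 * H := ⟨_, rfl⟩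
      have hck : c = 1 - b * (2 - b * l) := by rw [hFc, hl]; ring
      obtain ⟨k, hk⟩ : ∃ k, k = 2 - b * l := ⟨_, rfl⟩
      rw [← hk] at hck
      obtain ⟨n, hn⟩ : ∃ n, n = k ^ 2 * (1 + c ^ 2 * H') := ⟨_, rfl⟩
      have hdn : d = b ^ 2 * n := by
        rw [hFd, hn]
        linear_combination (1 + c ^ 2 * H') * (c - 1 - b * k) * hck
      have hn0 : n ≠ 0 := right_ne_zero_of_mul (hdn ▸ hd0)
      have hnew := IsElemPair.add_double (l := l) hc hP hb hck hn (by rw [hk]; ring) hS h1 h2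
      refine ⟨b, n, S, P, 1 + S * b * n, k, P' ^ 2 * m, hdn, rfl, hck,
        by rw [hP, hc]; ring, ?_, ?_, ?_⟩
      · convert h2 using 1
        ring
      · rw [hdn]; exact hnew
      · rw [hdn]; exact intPolyHom_double_add hb0 hc0 hn0
  intro N
  cases N with
  | zero => simpa using (IsElemPair.one_left (y 0)).hasSpecializableContFrac (hne 0)
  | succ N =>
    obtain ⟨a, m, P', S, P, k', ρ, -, -, -, -, -, hE, hs⟩ := key N
    rw [hs]
    exact hE.hasSpecializableContFrac (mul_ne_zero (hne _) (hne _))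

theorem sumsSpecializable_of_single {h : ℤ[X]} (hy : ∀ n, y (n + 1) = F.comp (y n))
    (hne : ∀ n, y n ≠ 0) (hF : F = (X - 1) ^ 2 * (1 + X + X ^ 2 * h)) : SumsSpecializable y := by
  have hFr : ∀ n, y (n + 1) = (y n - 1) ^ 2 * (1 + y n + y n ^ 2 * h.comp (y n)) := by
    intro n
    have := congrArg (fun p => p.comp (y n)) hF
    simpa [hy] using this
  have key : ∀ N, ∃ a d e m md me P' S P T U k' kd l', a ≠ 0 ∧ a = e ^ 2 * me ∧
      P' = 1 + T * e * me ∧ y N = d ^ 2 * md ∧ S = 1 + U * d * md ∧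
      y (N + 1) = a ^ 2 * m ∧ P = 1 + P' * a * m ∧ a = 1 - d * kd ∧
      y N = 1 - a * k' ∧ k' = 1 + a * l' ∧
      IsElemPair (T * d + U * e) (e * d) ∧ IsElemPair (U * a + P' * d) (d * a) ∧
      IsElemPair (P' * y N + S * a) (a * y N) ∧
      IsElemPair (P * y N + S * y (N + 1)) (y N * y (N + 1)) ∧
      ∑ n ∈ Finset.range (N + 1 + 1), 1 / intPolyHom (y n)
        = intPolyHom (P * y N + S * y (N + 1)) / intPolyHom (y N * y (N + 1)) := by
    intro N
    induction N with
    | zero =>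
      -- The three missing iterates are set to 1; T = -1 then makes P' = 0, the empty sum.
      refine ⟨1, 1, 1, y 1, y 0, 1, 0, 1, 1, -1, 0, 1 - y 0, 0, -y 0, one_ne_zero, by ring,
        by ring, by ring, by ring, by ring, by ring, by ring, by ring, by ring, ?_, ?_, ?_, ?_, ?_⟩
      · simpa using IsElemPair.one_right (-1 : ℤ[X])
      · simpa using IsElemPair.one_right (0 : ℤ[X])
      · simpa using IsElemPair.one_left (y 0)
      · have h1 := (IsElemPair.one_left (y 0)).add_frac (u := 0) (v := 1) (n := 1) (m := y 1)
          (by ring) ?_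
        · convert h1 using 1
          ring
        · refine (IsElemPair.one_left (1 * y 0 ^ 2)).congr_left
            ⟨-1 + y 0 + (y 0 - 1) ^ 2 * h.comp (y 0), ?_⟩
          linear_combination hFr 0
      · have := intPolyHom_div_add (p := 1) (hne 0) (hne 1)
        rw [Finset.sum_range_succ, Finset.sum_range_one]
        rw [map_one] at this
        rw [this]
        congr 2
        ring
    | succ N ih =>
      obtain ⟨a, d, e, m, md, me, P', S, P, T, U, k', kd, l', ha0, ha, hP', hbd, hS, hc, hP, had,
        hb, hk', h0, h0', h1, h2, hs⟩ := ih
      have hb0 := hne N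
      have hc0 := hne (N + 1)
      have hz0 := hne (N + 1 + 1)
      have hFc := hFr N
      have hFd := hFr (N + 1)
      rw [Finset.sum_range_succ, hs]
      generalize h.comp (y N) = H at *
      generalize h.comp (y (N + 1)) = H' at *
      generalize y (N + 1 + 1) = z at *
      generalize y (N + 1) = c at *
      generalize y N = b at *
      obtain ⟨l, hl⟩ : ∃ l, l = 1 - b - (1 - b) ^ 2 * H := ⟨_, rfl⟩
      have hck : c = 1 - b * (1 + b * l) := by rw [hFc, hl]; ring
      obtain ⟨k, hk⟩ : ∃ k, k = 1 + b * l := ⟨_, rfl⟩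
      rw [← hk] at hck
      obtain ⟨n, hn⟩ : ∃ n, n = k ^ 2 * (1 + c + c ^ 2 * H') := ⟨_, rfl⟩
      have hzn : z = b ^ 2 * n := by
        rw [hFd, hn]
        linear_combination (1 + c + c ^ 2 * H') * (c - 1 - b * k) * hck
      have hn0 : n ≠ 0 := right_ne_zero_of_mul (hzn ▸ hz0)
      have hnew := IsElemPair.add_single ha0 ha hP' hbd hS hc hP had hb hck hk' hk hn h0 h1 h2
      refine ⟨b, a, d, n, m, md, S, P, 1 + S * b * n, U, P', k, k', l, hb0, hbd, hS, hc, hP, hzn,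
        rfl, hb, hck, hk, h0', h1, ?_, ?_, ?_⟩
      · convert h2 using 1
        ring
      · rw [hzn]; exact hnew
      · rw [hzn]; exact intPolyHom_double_add hb0 hc0 hn0
  intro N
  cases N with
  | zero => simpa using (IsElemPair.one_left (y 0)).hasSpecializableContFrac (hne 0)
  | succ N =>
    obtain ⟨_, _, _, _, _, _, _, _, _, _, _, _, _, _, _, _, _, _, _, _, _, _, _, _, _, _, _, hE, hs⟩ :=
      key N
    rw [hs]
    exact hE.hasSpecializableContFrac (mul_ne_zero (hne _) (hne _))

end Sequences

/-! ### Iterates -/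

theorem natDegree_polyIterate (f : ℤ[X]) (n : ℕ) :
    (polyIterate f n).natDegree = f.natDegree ^ n := by
  induction n with
  | zero => simp [polyIterate]
  | succ n ih => rw [polyIterate, natDegree_comp, ih, pow_succ']

theorem polyIterate_ne_zero {f : ℤ[X]} (hf : 1 < f.natDegree) (n : ℕ) : polyIterate f n ≠ 0 := by
  intro h
  have := natDegree_polyIterate f n
  rw [h, natDegree_zero] at this
  exact absurd this.symm (pow_ne_zero _ (by omega))

theorem forall_hasSpecializableContFrac_iff {f : ℤ[X]} :
    (∀ N, HasSpecializableContFrac (iterSum f N)) ↔ SumsSpecializable (polyIterate f) := Iff.rfl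

theorem HasSpecializableContFrac.neg {r : RatFunc ℚ} (h : HasSpecializableContFrac r) :
    HasSpecializableContFrac (-r) := by
  obtain ⟨p, q, hE, hq, rfl⟩ := h.exists_isElemPair
  rw [← neg_div, ← map_neg]
  exact hE.neg_left.hasSpecializableContFrac hq

/-- The conjugate `-f(-x)` of `f` by `x ↦ -x`. -/
noncomputable def conjNeg (f : ℤ[X]) : ℤ[X] := -f.comp (-X)

theorem natDegree_conjNeg (f : ℤ[X]) : (conjNeg f).natDegree = f.natDegree := by
  rw [conjNeg, natDegree_neg, natDegree_comp, natDegree_neg, natDegree_X, mul_one]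

theorem conjNeg_conjNeg (f : ℤ[X]) : conjNeg (conjNeg f) = f := by
  simp [conjNeg, comp_assoc]

theorem neg_polyIterate_succ (f : ℤ[X]) (n : ℕ) :
    -polyIterate f (n + 1) = (conjNeg f).comp (-polyIterate f n) := by
  simp [conjNeg, polyIterate, comp_assoc]

/-- This transfers the case f(0) = 1 to f(0) = -1: the negated orbit of f is an orbit of -f(-x). -/
theorem SumsSpecializable.of_neg {y : ℕ → ℤ[X]} (h : SumsSpecializable fun n => -y n) :
    SumsSpecializable y := by
  intro N
  have := (h N).neg
  rw [← Finset.sum_neg_distrib] at this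
  convert this using 2 with n
  rw [map_neg, one_div_neg_eq_neg_one_div, neg_neg]

theorem PolyCongr.conjNeg {f r m : ℤ[X]} (h : PolyCongr f r m) :
    PolyCongr (conjNeg f) (conjNeg r) (m.comp (-X)) := by
  have := map_dvd (compRingHom (-X)) h
  rw [PolyCongr, _root_.conjNeg, _root_.conjNeg, ← dvd_neg]
  simpa [add_comm, sub_eq_add_neg] using this

/-- The congruences that make the sums over orbits passing near `0 ↦ 1` specializable. -/
def OneCongr (f : ℤ[X]) : Prop :=
  PolyCongr f 1 (X ^ 2 * (X - 1)) ∨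
    ∃ r ∈ ([X ^ 3 - X ^ 2 - X + 1, -X ^ 3 + 2 * X ^ 2 - X + 1, -X ^ 3 + 3 * X ^ 2 - 2 * X + 1,
      X ^ 2 - X + 1, X ^ 2 - 2 * X + 1] : List ℤ[X]), PolyCongr f r (X ^ 2 * (X - 1) ^ 2)

theorem sumsSpecializable_of_oneCongr {y : ℕ → ℤ[X]} {F : ℤ[X]}
    (hy : ∀ n, y (n + 1) = F.comp (y n)) (hne : ∀ n, y n ≠ 0) (hF : OneCongr F) :
    SumsSpecializable y := by
  rcases hF with ⟨h, hh⟩ | ⟨r, hr, h, hh⟩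
  · exact sumsSpecializable_of_dvd_sub_one (w := X * h) (j := 0) hy hne
      (by rw [hh]; ring) (Or.inl rfl) ⟨h, by ring⟩ ⟨0, by ring⟩
  · simp only [List.mem_cons, List.not_mem_nil, or_false] at hr
    rcases hr with rfl | rfl | rfl | rfl | rfl
    · exact sumsSpecializable_of_single (h := h) hy hne (by linear_combination hh)
    · exact sumsSpecializable_of_sub_one_sq_dvd (w := -1 + X * h) hy hne
        (by linear_combination hh) ⟨h, by ring⟩
    · exact sumsSpecializable_of_dvd_sub_one (w := 2 - X + X * (X - 1) * h) (j := 2) hy hne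
        (by linear_combination hh) (Or.inr (Or.inr rfl)) ⟨-1 + (X - 1) * h, by ring⟩
        ⟨-2 + 2 * X * h, by ring⟩
    · exact sumsSpecializable_of_dvd_sub_one (w := 1 + X * (X - 1) * h) (j := 1) hy hne
        (by linear_combination hh) (Or.inr (Or.inl rfl)) ⟨(X - 1) * h, by ring⟩
        ⟨X * h, by ring⟩
    · exact sumsSpecializable_of_double (h := h) hy hne (by linear_combination hh)

/-- The mirror images of the congruences in `OneCongr`. -/
theorem oneCongr_conjNeg_iff {f : ℤ[X]} :
    OneCongr (conjNeg f) ↔ (PolyCongr f (-1) (X ^ 2 * (X + 1)) ∨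
      ∃ r ∈ ([X ^ 3 + X ^ 2 - X - 1, -X ^ 3 - 2 * X ^ 2 - X - 1, -X ^ 3 - 3 * X ^ 2 - 2 * X - 1,
        -X ^ 2 - X - 1, -X ^ 2 - 2 * X - 1] : List ℤ[X]),
          PolyCongr f r (X ^ 2 * (X + 1) ^ 2)) := by
  have key : ∀ {g r r' m m' : ℤ[X]}, conjNeg r = r' → m' ∣ m.comp (-X) → PolyCongr g r m →
      PolyCongr (conjNeg g) r' m' := by
    rintro g r _ m m' rfl hm h
    exact hm.trans h.conjNeg
  have hf := conjNeg_conjNeg f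
  have d1 : (X ^ 2 * (X + 1) : ℤ[X]) ∣ (X ^ 2 * (X - 1) : ℤ[X]).comp (-X) := ⟨-1, by simp; ring⟩
  have d2 : (X ^ 2 * (X + 1) ^ 2 : ℤ[X]) ∣ (X ^ 2 * (X - 1) ^ 2 : ℤ[X]).comp (-X) :=
    ⟨1, by simp; ring⟩
  have d3 : (X ^ 2 * (X - 1) : ℤ[X]) ∣ (X ^ 2 * (X + 1) : ℤ[X]).comp (-X) := ⟨-1, by simp; ring⟩
  have d4 : (X ^ 2 * (X - 1) ^ 2 : ℤ[X]) ∣ (X ^ 2 * (X + 1) ^ 2 : ℤ[X]).comp (-X) :=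
    ⟨1, by simp; ring⟩
  simp only [OneCongr, List.mem_cons, List.not_mem_nil, or_false, or_and_right, exists_or,
    exists_eq_left]
  refine or_congr ?_ (or_congr ?_ (or_congr ?_ (or_congr ?_ (or_congr ?_ ?_))))
  · exact ⟨fun h => hf ▸ key (by simp [conjNeg]) d1 h, key (by simp [conjNeg]) d3⟩
  all_goals
    exact ⟨fun h => hf ▸ key (by simp [conjNeg]; ring) d2 h, key (by simp [conjNeg]; ring) d4⟩

theorem isSpecPair_of_sumsSpecializable {f : ℤ[X]} (hf : 1 < f.natDegree)
    (h : SumsSpecializable (polyIterate f)) :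
    IsSpecPair (X + f) (X * f) ∧
    IsSpecPair ((X + f) * f.comp f + X * f) (X * f * f.comp f) ∧
    IsSpecPair (((X + f) * f.comp f + X * f) * f.comp (f.comp f) + X * f * f.comp f)
      (X * f * f.comp f * f.comp (f.comp f)) := by
  have e1 : polyIterate f 1 = f := by simp [polyIterate]
  have e2 : polyIterate f 2 = f.comp f := by simp [polyIterate]
  have e3 : polyIterate f 3 = f.comp (f.comp f) := by simp [polyIterate]
  have n0 : (X : ℤ[X]) ≠ 0 := X_ne_zero
  have n1 := polyIterate_ne_zero hf 1
  have n2 := polyIterate_ne_zero hf 2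
  have n3 := polyIterate_ne_zero hf 3
  have h1 := h 1
  have h2 := h 2
  have h3 := h 3
  simp only [Finset.sum_range_succ, Finset.sum_range_zero, zero_add, e1, e2, e3] at h1 h2 h3
  rw [e1] at n1
  rw [e2] at n2
  rw [e3] at n3
  have e0 : (1 : RatFunc ℚ) / intPolyHom (polyIterate f 0) = intPolyHom 1 / intPolyHom X := by
    simp [polyIterate]
  rw [e0, intPolyHom_div_add n0 n1] at h1 h2 h3
  rw [intPolyHom_div_add (mul_ne_zero n0 n1) n2] at h2 h3
  rw [intPolyHom_div_add (mul_ne_zero (mul_ne_zero n0 n1) n2) n3] at h3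
  refine ⟨?_, ?_, ?_⟩
  · convert IsSpecPair.of_hasSpecializableContFrac (mul_ne_zero n0 n1) h1 using 1; ring
  · convert IsSpecPair.of_hasSpecializableContFrac (mul_ne_zero (mul_ne_zero n0 n1) n2) h2
      using 1
    ring
  · convert IsSpecPair.of_hasSpecializableContFrac
      (mul_ne_zero (mul_ne_zero (mul_ne_zero n0 n1) n2) n3) h3 using 1
    ring

theorem conjNeg_comp_conjNeg (f g : ℤ[X]) : (conjNeg f).comp (conjNeg g) = conjNeg (f.comp g) := by
  simp [conjNeg, comp_assoc]

theorem oneCongr_of_sumsSpecializable {f : ℤ[X]} (hf : 1 < f.natDegree)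
    (h : SumsSpecializable (polyIterate f)) (hf0 : f.eval 0 ≠ 0) :
    OneCongr f ∨ OneCongr (conjNeg f) := by
  obtain ⟨h1, h2, h3⟩ := isSpecPair_of_sumsSpecializable hf h
  have he : f.eval 0 = 1 ∨ f.eval 0 = -1 := by
    have := h1.eval_zero_eq (by simpa using hf0) (by simp) fun π hπ hπX h1 h2 => by
      rcases hπ.dvd_or_dvd h2 with h | h
      · exact hπX h
      · exact hπX ((dvd_add_left h).mp h1)
    simpa using this
  rcases he with he | he
  · exact Or.inl (necessity_one hf he h1 h2 h3)
  · right
    have hc : ∀ p : ℤ[X], compRingHom (-X) p = -conjNeg p := fun p => by simp [conjNeg]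
    -- Substituting -x contributes one sign per factor, so numerator and denominator always differ
    -- by a sign; the entry that turns negative alternates with N.
    have h1' := (h1.map (compRingHom (-X))).neg_left
    have h2' := (h2.map (compRingHom (-X))).neg_right
    have h3' := (h3.map (compRingHom (-X))).neg_left
    simp only [map_add, map_mul] at h1' h2' h3'
    simp only [hc, ← conjNeg_comp_conjNeg] at h1' h2' h3'
    have hX : conjNeg (X : ℤ[X]) = X := by simp [conjNeg]
    rw [hX] at h1' h2' h3'
    refine necessity_one (by rwa [natDegree_conjNeg]) (by simp [conjNeg, eval_comp, he]) ?_ ?_ ?_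
    · convert h1' using 1 <;> ring
    · convert h2' using 1 <;> ring
    · convert h3' using 1 <;> ring

theorem mainTheorem2 (f : ℤ[X]) (hf : 1 < f.natDegree) :
    (∀ N : ℕ, HasSpecializableContFrac (iterSum f N)) ↔
      (PolyCongr f 0 (X ^ 2) ∨
       PolyCongr f (-X) (X ^ 2) ∨
       PolyCongr f 1 (X ^ 2 * (X - 1)) ∨
       PolyCongr f (-1) (X ^ 2 * (X + 1)) ∨
       PolyCongr f (X ^ 3 - X ^ 2 - X + 1) (X ^ 2 * (X - 1) ^ 2) ∨
       PolyCongr f (-X ^ 3 + 2 * X ^ 2 - X + 1) (X ^ 2 * (X - 1) ^ 2) ∨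
       PolyCongr f (-X ^ 3 + 3 * X ^ 2 - 2 * X + 1) (X ^ 2 * (X - 1) ^ 2) ∨
       PolyCongr f (X ^ 3 + X ^ 2 - X - 1) (X ^ 2 * (X + 1) ^ 2) ∨
       PolyCongr f (-X ^ 3 - 2 * X ^ 2 - X - 1) (X ^ 2 * (X + 1) ^ 2) ∨
       PolyCongr f (-X ^ 3 - 3 * X ^ 2 - 2 * X - 1) (X ^ 2 * (X + 1) ^ 2) ∨
       PolyCongr f (X ^ 2 - X + 1) (X ^ 2 * (X - 1) ^ 2) ∨
       PolyCongr f (X ^ 2 - 2 * X + 1) (X ^ 2 * (X - 1) ^ 2) ∨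
       PolyCongr f (-X ^ 2 - X - 1) (X ^ 2 * (X + 1) ^ 2) ∨
       PolyCongr f (-X ^ 2 - 2 * X - 1) (X ^ 2 * (X + 1) ^ 2)) := by
  rw [forall_hasSpecializableContFrac_iff]
  have hne := polyIterate_ne_zero hf
  suffices H : SumsSpecializable (polyIterate f) ↔
      PolyCongr f 0 (X ^ 2) ∨ PolyCongr f (-X) (X ^ 2) ∨ OneCongr f ∨ OneCongr (conjNeg f) by
    rw [H, oneCongr_conjNeg_iff, OneCongr]
    simp only [List.mem_cons, List.not_mem_nil, or_false, or_and_right, exists_or, exists_eq_left]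
    refine Iff.of_eq ?_
    ac_rfl
  constructor
  · intro h
    by_cases hf0 : f.eval 0 = 0
    · obtain ⟨g, hg⟩ : X ∣ f := by rwa [X_dvd_iff, coeff_zero_eq_eval_zero]
      obtain ⟨h1, h2, -⟩ := isSpecPair_of_sumsSpecializable hf h
      have hg0 : g ≠ 0 := by rintro rfl; simp [hg] at hf
      rcases necessity_zero hg h1 h2 hg0 with h0 | h0
      · left
        obtain ⟨k, hk⟩ : X ∣ g := by rwa [X_dvd_iff, coeff_zero_eq_eval_zero]
        exact ⟨k, by rw [hg, hk]; ring⟩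
      · right; left
        obtain ⟨k, hk⟩ : X ∣ g + 1 := by
          rw [X_dvd_iff, coeff_zero_eq_eval_zero]; simp [h0]
        exact ⟨k, by linear_combination hg + X * hk⟩
    · exact Or.inr (Or.inr (oneCongr_of_sumsSpecializable hf h hf0))
  · rintro (h | h | h | h)
    · exact sumsSpecializable_of_sq_dvd (fun _ => rfl) hne (by simpa [PolyCongr] using h)
    · exact sumsSpecializable_of_sq_dvd_add (fun _ => rfl) hne (by simpa [PolyCongr] using h)
    · exact sumsSpecializable_of_oneCongr (fun _ => rfl) hne h
    · exact SumsSpecializable.of_neg (sumsSpecializable_of_oneCongr (neg_polyIterate_succ f)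
        (fun n => neg_ne_zero.mpr (hne n)) h)
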